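/- For each $n\ge 1$ let $p=p_n$, and let $x_1,\dots,x_n$ be i.i.d. observations of a nonparanormal vector $X=(X_1,\dots,X_p)$: there are monotone increasing functions $f_1,\dots,f_p:\mathbb R\to\mathbb R$ with $(f_1(X_1),\dots,f_p(X_p))\sim N_p(0,\Sigma^*)$, where $\Sigma^*=\Sigma^*_n$ is positive definite with unit diagonal. Put $\Theta^*=(\theta^*_{ij})=(\Sigma^*)^{-1}$, $\mathcal A=\{(i,j):i\ne j,\ \theta^*_{ij}\ne 0\}$ (assumed nonempty), $\mathcal A_k=\{j\ne k:\theta^*_{kj}\ne0\}$, $\tilde{\mathcal A}_k=\mathcal A_k\cup\{k\}$, $d=\max_k|\mathcal A_k|$, $\psi_{\min}=\min_{(i,j)\in\mathcal A}|\theta^*_{ij}|$, $M=\|\Theta^*\|_{\ell_1}$ (maximal absolute column sum), $\tilde G_k=\|(\Sigma^*_{\tilde{\mathcal A}_k\tilde{\mathcal A}_k})^{-1}\|_{\ell_\infty}$ and $\tilde H_k=\|\Sigma^*_{\tilde{\mathcal A}_k^c\tilde{\mathcal A}_k}(\Sigma^*_{\tilde{\mathcal A}_k\tilde{\mathcal A}_k})^{-1}\|_{\ell_\infty}$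 (maximal absolute row sums). Let $\hat r_{ij}$ be Spearman's rank correlation (Pearson's correlation of the ranks) of the observations of $X_i$ and $X_j$, and let $\hat R^s=(2\sin(\tfrac{\pi}{6}\hat r_{ij}))_{i,j}$. The rank-based CLIME $\hat\Theta_c^s$ minimizes $\sum_{i,j}|\theta_{ij}|$ over $\Theta\in\mathbb R^{p\times p}$ subject to $|(\hat R^s\Theta-I)_{ij}|\le\lambda_c$ for all $i,j$. With the weights $w_{ij}=(|\hat\theta^{s.c}_{ij}|+\frac1n)^{-1}$, where $\hat\theta^{s.c}_{ij}$ are the entries of $\hat\Theta^s_c$, the rank-based adaptive CLIME $\hat\Theta_{ac}^s=(\hat\theta^{s.ac}_{ij})$ minimizes $\sum_{i,j}w_{ij}|\theta_{ij}|$ subject to $|(\hat R^s\Theta-I)_{ij}|\le\lambda_{ac}w_{ij}$ for all $i,j$. There is an absolute constant $C>0$ such that the following holds. Suppose that, as $n\to\infty$, $\psi_{\min}$ is bounded below by a positive constant and $M$, $\max_k\tilde G_k$, $\max_k\tilde H_k$ are bounded above by constants; that $n\gg d^2\log p$ and $\min_k\lambda_{\min}(\Sigma^*_{\tilde{\mathcal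 A}_k\tilde{\mathcal A}_k})\gg d\sqrt{\log p/n}$; and that the tuning parameters satisfy, for all large $n$, $CM\sqrt{\log p/n}\le\lambda_c\le\frac1d$, together with $\lambda_c=O(\sqrt{\log p/n})$, $\lambda_{ac}>0$ and $$\min\Bigl\{\tfrac1d\min_k\lambda_{\min}(\Sigma^*_{\tilde{\mathcal A}_k\tilde{\mathcal A}_k}),\ \tfrac1d\Bigr\}\gg\lambda_{ac}\gg\lambda_c .$$ Then, with probability tending to $1$, optimal solutions $\hat\Theta_c^s$ exist and, for every choice of $\hat\Theta_c^s$, optimal solutions $\hat\Theta_{ac}^s$ exist and every one of them is sign consistent: $\operatorname{sign}(\hat\theta^{s.ac}_{ij})=\operatorname{sign}(\theta^*_{ij})$ for all $(i,j)\in\mathcal A$, and $\operatorname{sign}(\hat\theta^{s.ac}_{ij})=0$ for all $(i,j)\notin\mathcal A$ with $i\ne j$. (Here $a\gg b$ means $b=o(a)$ as $n\to\infty$.) -/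

import Mathlib

open Filter Topology Asymptotics MeasureTheory ProbabilityTheory

noncomputable section

namespace RankClime

/-! ### The nonparanormal model -/

/-- `P` is a nonparanormal (Gaussian copula) law on `ℝᵖ` with covariance parameter `Sig`: some
coordinatewise monotone increasing transformation carries `P` to `N(0, Sig)`, where `Sig` has unit
diagonal. -/
structure IsNonparanormal {p : ℕ} (P : Measure (Fin p → ℝ)) (Sig : Matrix (Fin p) (Fin p) ℝ) :
    Prop where
  posDef : Sig.PosDef
  diag_eq_one : ∀ i, Sig i i = 1
  exists_transform : ∃ f : Fin p → ℝ → ℝ, (∀ j, Monotone (f j)) ∧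
    P.map (fun x => WithLp.toLp 2 (fun j => f j (x j))) = multivariateGaussian 0 Sig

/-! ### Spearman's rank correlation and the adjusted rank-based correlation matrix -/

/-- The ranks of the values `v 0, …, v (n - 1)`: `rank v k` is the number of `l` such that
`v l ≤ v k`. (Under the nonparanormal model there are almost surely no ties.) -/
def rank {n : ℕ} (v : Fin n → ℝ) (k : Fin n) : ℝ :=
  ((Finset.univ.filter fun l => v l ≤ v k).card : ℝ)

/-- The sample mean. -/
def sampleMean {n : ℕ} (a : Fin n → ℝ) : ℝ := (∑ k, a k) / n

/-- Pearson's sample correlation. -/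
def pearson {n : ℕ} (a b : Fin n → ℝ) : ℝ :=
  (∑ k, (a k - sampleMean a) * (b k - sampleMean b)) /
    (√(∑ k, (a k - sampleMean a) ^ 2) * √(∑ k, (b k - sampleMean b) ^ 2))

/-- Spearman's rank correlation: Pearson's correlation of the ranks. -/
def spearman {n : ℕ} (a b : Fin n → ℝ) : ℝ := pearson (rank a) (rank b)

/-- The adjusted Spearman correlation matrix of the data `x` (`x k i` is the `k`-th observation of
variable `i`), with entries `2 sin (π r / 6)`. -/
def rankCorr {n p : ℕ} (x : Fin n → Fin p → ℝ) : Matrix (Fin p) (Fin p) ℝ :=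
  Matrix.of fun i j =>
    2 * Real.sin (Real.pi / 6 * spearman (fun k => x k i) (fun k => x k j))

/-! ### CLIME and adaptive CLIME -/

/-- The entrywise `ℓ₁` norm of a matrix. -/
def entryL1 {p : ℕ} (A : Matrix (Fin p) (Fin p) ℝ) : ℝ := ∑ i, ∑ j, |A i j|

/-- `T` is an optimal solution of: minimize `‖Θ‖₁` subject to `‖R Θ - I‖_max ≤ lam`. -/
def IsClime {p : ℕ} (R : Matrix (Fin p) (Fin p) ℝ) (lam : ℝ) (T : Matrix (Fin p) (Fin p) ℝ) :
    Prop :=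
  (∀ i j, |(R * T - 1) i j| ≤ lam) ∧
    ∀ T' : Matrix (Fin p) (Fin p) ℝ, (∀ i j, |(R * T' - 1) i j| ≤ lam) → entryL1 T ≤ entryL1 T'

/-- `T` is an optimal solution of: minimize `‖W ∘ Θ‖₁` subject to `|R Θ - I| ≤ lam W`
(entrywise), where `∘` is the Hadamard product. -/
def IsAdaptiveClime {p : ℕ} (R W : Matrix (Fin p) (Fin p) ℝ) (lam : ℝ)
    (T : Matrix (Fin p) (Fin p) ℝ) : Prop :=
  (∀ i j, |(R * T - 1) i j| ≤ lam * W i j) ∧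
    ∀ T' : Matrix (Fin p) (Fin p) ℝ, (∀ i j, |(R * T' - 1) i j| ≤ lam * W i j) →
      entryL1 (Matrix.hadamard W T) ≤ entryL1 (Matrix.hadamard W T')

/-- The adaptive weights `(|T| + 1/n)⁻¹` (entrywise). -/
def climeWeight {p : ℕ} (n : ℕ) (T : Matrix (Fin p) (Fin p) ℝ) : Matrix (Fin p) (Fin p) ℝ :=
  Matrix.of fun i j => (|T i j| + 1 / (n : ℝ))⁻¹

/-! ### The parameters of the underlying graph -/

/-- The support of the off-diagonal entries of `T`. -/
def offSupport {p : ℕ} (T : Matrix (Fin p) (Fin p) ℝ) : Set (Fin p × Fin p) :=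
  {e | e.1 ≠ e.2 ∧ T e.1 e.2 ≠ 0}

/-- The smallest absolute value of the off-diagonal nonzero entries of `T`. -/
def psiMin {p : ℕ} (T : Matrix (Fin p) (Fin p) ℝ) : ℝ :=
  ⨅ e : offSupport T, |T e.1.1 e.1.2|

/-- The active set of node `k`: the `j ≠ k` with `T k j ≠ 0`. -/
def activeSet {p : ℕ} (T : Matrix (Fin p) (Fin p) ℝ) (k : Fin p) : Finset (Fin p) :=
  Finset.univ.filter fun j => j ≠ k ∧ T k j ≠ 0

/-- The active set of node `k`, together with `k`. -/
def activeSet' {p : ℕ} (T : Matrix (Fin p) (Fin p) ℝ) (k : Fin p) : Finset (Fin p) :=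
  insert k (activeSet T k)

/-- The maximal degree of the graph of `T`. -/
def maxDegree {p : ℕ} (T : Matrix (Fin p) (Fin p) ℝ) : ℕ :=
  Finset.univ.sup fun k => (activeSet T k).card

/-- The matrix `ℓ₁` norm: the maximal absolute column sum. -/
def matrixL1 {ι κ : Type*} [Fintype ι] (A : Matrix ι κ ℝ) : ℝ := ⨆ j, ∑ i, |A i j|

/-- The matrix `ℓ_∞` norm: the maximal absolute row sum. -/
def matrixLinf {ι κ : Type*} [Fintype κ] (A : Matrix ι κ ℝ) : ℝ := ⨆ i, ∑ j, |A i j|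

/-- The submatrix of `A` with row indices in `S` and column indices in `S'`. -/
def sub {p : ℕ} (A : Matrix (Fin p) (Fin p) ℝ) (S S' : Finset (Fin p)) : Matrix S S' ℝ :=
  A.submatrix (fun i => (i : Fin p)) (fun j => (j : Fin p))

/-- `‖(Σ_{SS})⁻¹‖_{ℓ∞}` for `S` the active set of `k` in `Σ⁻¹` together with `k`. -/
def tildeG {p : ℕ} (Sig : Matrix (Fin p) (Fin p) ℝ) (k : Fin p) : ℝ :=
  matrixLinf (sub Sig (activeSet' Sig⁻¹ k) (activeSet' Sig⁻¹ k))⁻¹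

/-- `‖Σ_{SᶜS} (Σ_{SS})⁻¹‖_{ℓ∞}` for `S` the active set of `k` in `Σ⁻¹` together with `k`. -/
def tildeH {p : ℕ} (Sig : Matrix (Fin p) (Fin p) ℝ) (k : Fin p) : ℝ :=
  matrixLinf (sub Sig (activeSet' Sig⁻¹ k)ᶜ (activeSet' Sig⁻¹ k) *
    (sub Sig (activeSet' Sig⁻¹ k) (activeSet' Sig⁻¹ k))⁻¹)

/-- The smallest eigenvalue of a real symmetric matrix. -/
def eigMin {ι : Type*} [Fintype ι] [DecidableEq ι] (A : Matrix ι ι ℝ) : ℝ :=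
  sInf (spectrum ℝ A)

/-- The minimum over all nodes `k` of the smallest eigenvalue of `Σ_{SS}`, for `S` the active set
of `k` in `Σ⁻¹` together with `k`. -/
def activeEigMin {p : ℕ} (Sig : Matrix (Fin p) (Fin p) ℝ) : ℝ :=
  ⨅ k, eigMin (sub Sig (activeSet' Sig⁻¹ k) (activeSet' Sig⁻¹ k))

/-! ### Sign consistency -/

/-- `T` recovers the signs of the off-diagonal entries of `T₀`. -/
def SignConsistent {p : ℕ} (T T₀ : Matrix (Fin p) (Fin p) ℝ) : Prop :=
  (∀ i j, (i, j) ∈ offSupport T₀ → SignType.sign (T i j) = SignType.sign (T₀ i j)) ∧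
    ∀ i j, i ≠ j → (i, j) ∉ offSupport T₀ → SignType.sign (T i j) = 0

/-- The two-stage procedure based on the matrix `R` succeeds: the CLIME program has an optimal
solution and, whichever one is used to build the weights, the adaptive CLIME program has an optimal
solution and all of its optimal solutions are sign consistent for `T₀`. -/
def AdaptiveClimeSucceeds {p : ℕ} (n : ℕ) (R T₀ : Matrix (Fin p) (Fin p) ℝ) (lamc lamac : ℝ) :
    Prop :=
  (∃ T, IsClime R lamc T) ∧
    ∀ T, IsClime R lamc T →
      (∃ U, IsAdaptiveClime R (climeWeight n T) lamac U) ∧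
        ∀ U, IsAdaptiveClime R (climeWeight n T) lamac U → SignConsistent U T₀

end RankClime

end

namespace RankClime

/-! ### Bounds on restricted linear systems -/

section RestrictedSystems

variable {ι : Type*} [Fintype ι]

lemma sum_subset_abs_eq {S : Finset ι} {v : ι → ℝ} (hv : ∀ i ∉ S, v i = 0) :
    ∑ i ∈ S, |v i| = ∑ i, |v i| :=
  Finset.sum_subset (Finset.subset_univ S) fun i _ hi => by simp [hv i hi]

/-- A linear system restricted to a set of coordinates is solvable as soon as it has a trivial
kernel. -/
lemma exists_restricted_solution [DecidableEq ι] (R : Matrix ι ι ℝ) (S : Finset ι)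
    (hinj : ∀ v : ι → ℝ, (∀ i ∉ S, v i = 0) → (∀ i ∈ S, (R.mulVec v) i = 0) → v = 0)
    (b : ι → ℝ) :
    ∃ v : ι → ℝ, (∀ i ∉ S, v i = 0) ∧ ∀ i ∈ S, (R.mulVec v) i = b i := by
  set A : Matrix ι ι ℝ := Matrix.of fun i j => if i ∈ S then R i j else if i = j then 1 else 0
    with hA
  have hAv : ∀ (v : ι → ℝ) i, A.mulVec v i = if i ∈ S then R.mulVec v i else v i := by
    intro v i
    by_cases hi : i ∈ S <;> simp [hA, Matrix.mulVec, dotProduct, hi]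
  have hinj' : Function.Injective A.mulVecLin := by
    rw [injective_iff_map_eq_zero]
    intro v hv
    have h0 : ∀ i, A.mulVec v i = 0 := fun i => congrFun hv i
    refine hinj v (fun i hi => ?_) fun i hi => ?_
    · simpa [hAv, hi] using h0 i
    · simpa [hAv, hi] using h0 i
  obtain ⟨v, hv⟩ := LinearMap.injective_iff_surjective.1 hinj' fun i => if i ∈ S then b i else 0
  have h0 : ∀ i, A.mulVec v i = if i ∈ S then b i else 0 := fun i => congrFun hv i
  refine ⟨v, fun i hi => ?_, fun i hi => ?_⟩
  · simpa [hAv, hi] using h0 i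
  · simpa [hAv, hi] using h0 i

lemma abs_mulVec_le {A : Matrix ι ι ℝ} {δ : ℝ} {i : ι} (hA : ∀ j, |A i j| ≤ δ) (v : ι → ℝ) :
    |A.mulVec v i| ≤ δ * ∑ j, |v j| := by
  simp only [Matrix.mulVec, dotProduct]
  refine (Finset.abs_sum_le_sum_abs _ _).trans ?_
  rw [Finset.mul_sum]
  refine Finset.sum_le_sum fun j _ => ?_
  rw [abs_mul]
  exact mul_le_mul_of_nonneg_right (hA j) (abs_nonneg _)

lemma abs_mulVec_sub_mulVec_le {R A : Matrix ι ι ℝ} {δ : ℝ} (hRA : ∀ i j, |R i j - A i j| ≤ δ)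
    (v : ι → ℝ) (i : ι) : |R.mulVec v i - A.mulVec v i| ≤ δ * ∑ j, |v j| := by
  rw [← Pi.sub_apply, ← Matrix.sub_mulVec]
  exact abs_mulVec_le (fun j => by simpa using hRA i j) v

/-- The `ℓ₁` estimate for restricted systems. With `u = 0` it bounds the inverse of the submatrix
of `A` on `S`; with equality of the two sides on `S` it is an irrepresentability bound. -/
def RestrictedBound (A : Matrix ι ι ℝ) (S : Finset ι) (G H : ℝ) : Prop :=
  ∀ v u : ι → ℝ, (∀ i ∉ S, v i = 0) → (∀ i ∈ S, u i = 0) →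
    ∑ i, |v i| ≤ H * ∑ i, |u i| + G * ∑ i ∈ S, |A.mulVec v i - A.mulVec u i|

lemma RestrictedBound.perturb {A R : Matrix ι ι ℝ} {S : Finset ι} {G H δ : ℝ}
    (h : RestrictedBound A S G H) (hG : 0 ≤ G) (hRA : ∀ i j, |R i j - A i j| ≤ δ)
    (hδ : G * (S.card * δ) ≤ 1 / 2) : RestrictedBound R S (2 * G) (2 * H + 1) := by
  intro v u hv hu
  have h1 := h v u hv hu
  have h2 : ∑ i ∈ S, |A.mulVec v i - A.mulVec u i| ≤
      ∑ i ∈ S, |R.mulVec v i - R.mulVec u i| +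
        S.card * δ * (∑ i, |v i| + ∑ i, |u i|) := by
    have : ∀ i ∈ S, |A.mulVec v i - A.mulVec u i| ≤
        |R.mulVec v i - R.mulVec u i| + δ * (∑ i, |v i| + ∑ i, |u i|) := by
      intro i _
      have e1 := abs_mulVec_sub_mulVec_le hRA v i
      have e2 := abs_mulVec_sub_mulVec_le hRA u i
      have : A.mulVec v i - A.mulVec u i = (R.mulVec v i - R.mulVec u i)
          + (-(R.mulVec v i - A.mulVec v i) + (R.mulVec u i - A.mulVec u i)) := by ring
      rw [this]
      refine (abs_add_le _ _).trans (add_le_add le_rfl ((abs_add_le _ _).trans ?_))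
      rw [abs_neg]
      linarith
    refine (Finset.sum_le_sum this).trans ?_
    rw [Finset.sum_add_distrib, Finset.sum_const, nsmul_eq_mul, mul_assoc]
  have hv0 : 0 ≤ ∑ i, |v i| := Finset.sum_nonneg fun _ _ => abs_nonneg _
  have hu0 : 0 ≤ ∑ i, |u i| := Finset.sum_nonneg fun _ _ => abs_nonneg _
  have h3 := mul_le_mul_of_nonneg_left h2 hG
  have h4 := mul_le_mul_of_nonneg_right hδ (add_nonneg hv0 hu0)
  linarith

lemma RestrictedBound.sum_abs_le {A : Matrix ι ι ℝ} {S : Finset ι} {G H : ℝ}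
    (h : RestrictedBound A S G H) {v : ι → ℝ} (hv : ∀ i ∉ S, v i = 0) :
    ∑ i, |v i| ≤ G * ∑ i ∈ S, |A.mulVec v i| := by
  simpa using h v 0 hv (by simp)

lemma RestrictedBound.exists_solution [DecidableEq ι] {A : Matrix ι ι ℝ} {S : Finset ι}
    {G H : ℝ} (h : RestrictedBound A S G H) (b : ι → ℝ) :
    ∃ v : ι → ℝ, (∀ i ∉ S, v i = 0) ∧ ∀ i ∈ S, (A.mulVec v) i = b i := by
  refine exists_restricted_solution A S (fun v hv h0 => ?_) b
  have h1 := h.sum_abs_le hv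
  have hz : ∑ i ∈ S, |A.mulVec v i| = 0 := Finset.sum_eq_zero fun i hi => by simp [h0 i hi]
  rw [hz, mul_zero] at h1
  have h2 := (Finset.sum_eq_zero_iff_of_nonneg fun i _ => abs_nonneg (v i)).1
    (le_antisymm h1 (Finset.sum_nonneg fun _ _ => abs_nonneg _))
  ext i
  simpa using h2 i (Finset.mem_univ i)

end RestrictedSystems

/-! ### The weighted program for one column -/

section Column

variable {ι : Type*} [Fintype ι] [DecidableEq ι]

/-- `t` is an optimal solution of: minimize `∑ w |t|` subject to `|R t - b| ≤ lam w`. -/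
def IsColumnOpt (R : Matrix ι ι ℝ) (w : ι → ℝ) (lam : ℝ) (b t : ι → ℝ) : Prop :=
  (∀ i, |R.mulVec t i - b i| ≤ lam * w i) ∧
    ∀ t' : ι → ℝ, (∀ i, |R.mulVec t' i - b i| ≤ lam * w i) →
      ∑ i, w i * |t i| ≤ ∑ i, w i * |t' i|

/-- If the weights off `S` are large, there is a feasible point supported in `S`. -/
lemma exists_feasible_column {R : Matrix ι ι ℝ} {S : Finset ι} {G H lam W : ℝ} {w : ι → ℝ}
    {k : ι} (hk : k ∈ S) (hR : RestrictedBound R S G H)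
    (hR2 : ∀ i j, |R i j| ≤ 2) (hlam : 0 ≤ lam) (hw : ∀ i, 0 ≤ w i)
    (hW : ∀ i ∉ S, W ≤ w i) (hlamW : 2 * G ≤ lam * W) :
    ∃ t : ι → ℝ, (∀ i ∉ S, t i = 0) ∧ (∑ i, |t i| ≤ G) ∧
      ∀ i, |R.mulVec t i - (Pi.single k 1 : ι → ℝ) i| ≤ lam * w i := by
  obtain ⟨t, ht, hRt⟩ := hR.exists_solution (Pi.single k 1)
  have hsum : ∑ i, |t i| ≤ G := by
    have := hR.sum_abs_le ht
    have e : ∑ i ∈ S, |R.mulVec t i| = 1 := by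
      rw [Finset.sum_congr rfl fun i hi => by rw [hRt i hi], Finset.sum_eq_single_of_mem k hk]
      · simp
      · intro b _ hb; simp [hb]
    rwa [e, mul_one] at this
  refine ⟨t, ht, hsum, fun i => ?_⟩
  by_cases hi : i ∈ S
  · rw [hRt i hi, sub_self, abs_zero]
    exact mul_nonneg hlam (hw i)
  · have hik : i ≠ k := fun h => hi (h ▸ hk)
    rw [Pi.single_eq_of_ne hik, sub_zero]
    calc _ ≤ 2 * ∑ j, |t j| := abs_mulVec_le (hR2 i) t
      _ ≤ 2 * G := by linarith
      _ ≤ lam * W := hlamW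
      _ ≤ _ := mul_le_mul_of_nonneg_left (hW i hi) hlam

/-- Optimal columns vanish off `S` and are bounded. -/
lemma IsColumnOpt.eq_zero_of_notMem {R : Matrix ι ι ℝ} {S : Finset ι} {G H lam W w₀ w₁ : ℝ}
    {w : ι → ℝ} {k : ι} {t : ι → ℝ} (ht : IsColumnOpt R w lam (Pi.single k 1) t) (hk : k ∈ S)
    (hR : RestrictedBound R S G H) (hG : 0 < G) (hH : 0 < H)
    (hR2 : ∀ i j, |R i j| ≤ 2) (hlam : 0 ≤ lam) (hw₀ : 0 < w₀)
    (hwS₀ : ∀ i ∈ S, w₀ ≤ w i) (hwS₁ : ∀ i ∈ S, w i ≤ w₁)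
    (hW : ∀ i ∉ S, W ≤ w i) (hWH : w₁ * H < W)
    (hlamW : 2 * (G * w₁ / w₀ + G) ≤ lam * W) :
    (∀ i ∉ S, t i = 0) ∧ ∑ i, |t i| ≤ G * w₁ / w₀ := by
  have hw₁ : 0 < w₁ := hw₀.trans_le ((hwS₀ k hk).trans (hwS₁ k hk))
  have hWpos : 0 < W := (mul_pos hw₁ hH).trans hWH
  have hw : ∀ i, 0 ≤ w i := fun i => by
    by_cases hi : i ∈ S
    · exact hw₀.le.trans (hwS₀ i hi)
    · exact hWpos.le.trans (hW i hi)
  have hq : 0 ≤ G * w₁ / w₀ := by positivity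
  obtain ⟨t₀, ht₀, hs₀, hf₀⟩ := exists_feasible_column hk hR hR2 hlam hw hW (by linarith)
  have hobj : ∑ i, w i * |t i| ≤ G * w₁ := by
    refine (ht.2 t₀ hf₀).trans ?_
    calc ∑ i, w i * |t₀ i| ≤ ∑ i, w₁ * |t₀ i| := by
          refine Finset.sum_le_sum fun i _ => ?_
          by_cases hi : i ∈ S
          · exact mul_le_mul_of_nonneg_right (hwS₁ i hi) (abs_nonneg _)
          · simp [ht₀ i hi]
      _ = w₁ * ∑ i, |t₀ i| := by rw [Finset.mul_sum]
      _ ≤ _ := by nlinarith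
  set u : ι → ℝ := fun i => if i ∈ S then 0 else t i with hu
  set s : ι → ℝ := fun i => if i ∈ S then t i else 0 with hs
  have hsu : t = s + u := by ext i; by_cases hi : i ∈ S <;> simp [hu, hs, hi]
  have hsplit : ∑ i, w i * |t i| = ∑ i, w i * |s i| + ∑ i, w i * |u i| := by
    rw [← Finset.sum_add_distrib]
    refine Finset.sum_congr rfl fun i _ => ?_
    by_cases hi : i ∈ S <;> simp [hu, hs, hi]
  have hus : W * ∑ i, |u i| ≤ ∑ i, w i * |u i| := by
    rw [Finset.mul_sum]
    refine Finset.sum_le_sum fun i _ => ?_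
    by_cases hi : i ∈ S
    · simp [hu, hi]
    · exact mul_le_mul_of_nonneg_right (hW i hi) (abs_nonneg _)
  have hss : w₀ * ∑ i, |s i| ≤ ∑ i, w i * |s i| := by
    rw [Finset.mul_sum]
    refine Finset.sum_le_sum fun i _ => ?_
    by_cases hi : i ∈ S
    · exact mul_le_mul_of_nonneg_right (hwS₀ i hi) (abs_nonneg _)
    · simp [hs, hi]
  have hu0 : 0 ≤ ∑ i, |u i| := Finset.sum_nonneg fun _ _ => abs_nonneg _
  have hs0 : 0 ≤ ∑ i, |s i| := Finset.sum_nonneg fun _ _ => abs_nonneg _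
  have hs1 : ∑ i, |s i| ≤ G * w₁ / w₀ := by
    rw [le_div_iff₀ hw₀]
    nlinarith
  obtain ⟨v, hv, hRv⟩ := hR.exists_solution (R.mulVec u)
  have hvu : ∑ i, |v i| ≤ H * ∑ i, |u i| := by
    have := hR v u hv fun i hi => by simp [hu, hi]
    have hz : ∑ i ∈ S, |R.mulVec v i - R.mulVec u i| = 0 :=
      Finset.sum_eq_zero fun i hi => by rw [hRv i hi, sub_self, abs_zero]
    rwa [hz, mul_zero, add_zero] at this
  have hv0 : 0 ≤ ∑ i, |v i| := Finset.sum_nonneg fun _ _ => abs_nonneg _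
  have hvG : ∑ i, |v i| ≤ G := by
    have h1 : W * ∑ i, |u i| ≤ G * w₁ := by nlinarith
    have h2 : w₁ * ∑ i, |v i| ≤ w₁ * G := by
      nlinarith [mul_le_mul_of_nonneg_left hvu hw₁.le, mul_le_mul_of_nonneg_right hWH.le hu0]
    exact le_of_mul_le_mul_left h2 hw₁
  have hfeas : ∀ i, |R.mulVec (s + v) i - (Pi.single k 1 : ι → ℝ) i| ≤ lam * w i := by
    intro i
    by_cases hi : i ∈ S
    · have := ht.1 i
      rw [hsu, Matrix.mulVec_add, Pi.add_apply] at this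
      rwa [Matrix.mulVec_add, Pi.add_apply, hRv i hi]
    · have hik : i ≠ k := fun h => hi (h ▸ hk)
      rw [Pi.single_eq_of_ne hik, sub_zero]
      calc _ ≤ 2 * ∑ j, |(s + v) j| := abs_mulVec_le (hR2 i) _
        _ ≤ 2 * (∑ j, |s j| + ∑ j, |v j|) := by
          rw [← Finset.sum_add_distrib]
          gcongr with j
          exact abs_add_le _ _
        _ ≤ lam * W := by linarith
        _ ≤ _ := mul_le_mul_of_nonneg_left (hW i hi) hlam
  have hopt := ht.2 _ hfeas
  have hle : ∑ i, w i * |(s + v) i| ≤ ∑ i, w i * |s i| + w₁ * ∑ i, |v i| := by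
    rw [Finset.mul_sum, ← Finset.sum_add_distrib]
    refine Finset.sum_le_sum fun i _ => ?_
    by_cases hi : i ∈ S
    · have := mul_le_mul_of_nonneg_left (abs_add_le (s i) (v i)) (hw i)
      have := mul_le_mul_of_nonneg_right (hwS₁ i hi) (abs_nonneg (v i))
      simp only [Pi.add_apply]
      linarith
    · simp [hs, hi, hv i hi]
  have huz : ∑ i, |u i| = 0 := by
    by_contra hne
    have hpos : 0 < ∑ i, |u i| := lt_of_le_of_ne hu0 (Ne.symm hne)
    have := mul_lt_mul_of_pos_right hWH hpos
    have := mul_le_mul_of_nonneg_left hvu hw₁.le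
    nlinarith
  have hu' := (Finset.sum_eq_zero_iff_of_nonneg fun i _ => abs_nonneg (u i)).1 huz
  have htS : ∀ i ∉ S, t i = 0 := fun i hi => by simpa [hu, hi] using hu' i (Finset.mem_univ i)
  refine ⟨htS, ?_⟩
  convert hs1 using 3 with i
  by_cases hi : i ∈ S
  · simp [hs, hi]
  · simp [hs, hi, htS i hi]

end Column

/-! ### Consequences of the bounds on the covariance matrix -/

section Covariance

lemma abs_mulVec_le_sum {ι κ : Type*} [Fintype κ] (A : Matrix ι κ ℝ) (v : κ → ℝ) (i : ι) :
    |A.mulVec v i| ≤ ∑ j, |A i j| * |v j| := by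
  simp only [Matrix.mulVec, dotProduct, ← abs_mul]
  exact Finset.abs_sum_le_sum_abs _ _

lemma sum_abs_row_le_matrixLinf {ι κ : Type*} [Finite ι] [Fintype κ] (A : Matrix ι κ ℝ) (i : ι) :
    ∑ j, |A i j| ≤ matrixLinf A :=
  le_ciSup (f := fun i => ∑ j, |A i j|) (Set.finite_range _).bddAbove i

lemma sum_abs_col_le_matrixL1 {ι κ : Type*} [Fintype ι] [Fintype κ] (A : Matrix ι κ ℝ) (j : κ) :
    ∑ i, |A i j| ≤ matrixL1 A :=
  le_ciSup (f := fun j => ∑ i, |A i j|) (Set.finite_range _).bddAbove j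

variable {p : ℕ} {Sig : Matrix (Fin p) (Fin p) ℝ}

lemma isSymm_of_posDef (h : Sig.PosDef) : Sig.IsSymm := by
  have := h.isHermitian
  rwa [Matrix.IsHermitian, Matrix.conjTranspose_eq_transpose_of_trivial] at this

lemma restrictedBound_activeSet' {G H : ℝ} (h : Sig.PosDef) (k : Fin p) (hG : tildeG Sig k ≤ G)
    (hH : tildeH Sig k ≤ H) : RestrictedBound Sig (activeSet' Sig⁻¹ k) G H := by
  intro v u hv hu
  unfold tildeG at hG
  unfold tildeH at hH
  generalize activeSet' Sig⁻¹ k = S at hG hH hv hu ⊢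
  have hsymm := isSymm_of_posDef h
  set A : Matrix S S ℝ := sub Sig S S with hA
  set D : Matrix (Sᶜ : Finset (Fin p)) S ℝ := sub Sig Sᶜ S with hD
  have hAdet : IsUnit A.det := by
    have : A.PosDef := h.submatrix Subtype.val_injective
    exact (Matrix.isUnit_iff_isUnit_det _).1 this.isUnit
  have hAsymm : A⁻¹.transpose = A⁻¹ := by
    rw [Matrix.transpose_nonsing_inv]
    congr 1
    ext i j
    exact hsymm.apply _ _
  set vS : S → ℝ := fun i => v i with hvS
  set uC : (Sᶜ : Finset (Fin p)) → ℝ := fun i => u i with huC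
  set e : S → ℝ := fun i => Sig.mulVec v i - Sig.mulVec u i with he
  have hAv : A.mulVec vS = e + D.transpose.mulVec uC := by
    ext i
    have h1 : A.mulVec vS i = Sig.mulVec v i := by
      simp only [Matrix.mulVec, dotProduct, hA, sub, Matrix.submatrix_apply, hvS]
      rw [Finset.sum_coe_sort S (fun j => Sig i j * v j)]
      exact Finset.sum_subset (Finset.subset_univ S) fun j _ hj => by simp [hv j hj]
    have h2 : D.transpose.mulVec uC i = Sig.mulVec u i := by
      simp only [Matrix.mulVec, dotProduct, hD, sub, Matrix.submatrix_apply, huC,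
        Matrix.transpose_apply]
      rw [Finset.sum_coe_sort Sᶜ (fun j => Sig j i * u j)]
      rw [Finset.sum_subset (Finset.subset_univ Sᶜ) fun j _ hj => by
        simp [hu j (by simpa using hj)]]
      exact Finset.sum_congr rfl fun j _ => by rw [hsymm.apply]
    rw [Pi.add_apply, h1, h2]
    simp [he]
  have hvS' : ∀ i, vS i = ∑ j, A⁻¹ j i * e j + ∑ j, (D * A⁻¹) j i * uC j := by
    intro i
    have h1 : vS = A⁻¹.mulVec (e + D.transpose.mulVec uC) := by
      rw [← hAv, Matrix.mulVec_mulVec, Matrix.nonsing_inv_mul _ hAdet, Matrix.one_mulVec]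
    have h2 : A⁻¹ * D.transpose = (D * A⁻¹).transpose := by
      rw [Matrix.transpose_mul, hAsymm]
    rw [h1, Matrix.mulVec_add, Matrix.mulVec_mulVec, h2, Pi.add_apply]
    congr 1
    · conv_lhs => rw [← hAsymm]
      rfl
  have hbound : ∑ i, |vS i| ≤ ∑ j, G * |e j| + ∑ j, H * |uC j| := by
    calc ∑ i, |vS i| ≤ ∑ i, (∑ j, |A⁻¹ j i| * |e j| + ∑ j, |(D * A⁻¹) j i| * |uC j|) := by
          refine Finset.sum_le_sum fun i _ => ?_
          rw [hvS' i]
          refine (abs_add_le _ _).trans (add_le_add ?_ ?_) <;>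
          · refine (Finset.abs_sum_le_sum_abs _ _).trans (le_of_eq ?_)
            exact Finset.sum_congr rfl fun j _ => abs_mul _ _
      _ = ∑ j, (∑ i, |A⁻¹ j i|) * |e j| + ∑ j, (∑ i, |(D * A⁻¹) j i|) * |uC j| := by
          simp only [Finset.sum_mul]
          rw [Finset.sum_add_distrib]
          exact congrArg₂ _ Finset.sum_comm Finset.sum_comm
      _ ≤ _ := by
          refine add_le_add ?_ ?_
          · exact Finset.sum_le_sum fun j _ => mul_le_mul_of_nonneg_right
              ((sum_abs_row_le_matrixLinf _ j).trans hG) (abs_nonneg _)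
          · exact Finset.sum_le_sum fun j _ => mul_le_mul_of_nonneg_right
              ((sum_abs_row_le_matrixLinf _ j).trans hH) (abs_nonneg _)
  rw [← Finset.mul_sum, ← Finset.mul_sum] at hbound
  have e1 : ∑ i, |vS i| = ∑ i, |v i| := by
    rw [← sum_subset_abs_eq hv]
    exact Finset.sum_coe_sort S fun i => |v i|
  have e2 : ∑ i, |uC i| = ∑ i, |u i| := by
    rw [← sum_subset_abs_eq (S := Sᶜ) (v := u) fun i hi => hu i (by simpa using hi)]
    exact Finset.sum_coe_sort Sᶜ fun i => |u i|
  have e3 : ∑ i, |e i| = ∑ i ∈ S, |Sig.mulVec v i - Sig.mulVec u i| :=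
    Finset.sum_coe_sort S fun i => |Sig.mulVec v i - Sig.mulVec u i|
  rw [e1, e2, e3] at hbound
  linarith

lemma mul_inv_of_posDef (h : Sig.PosDef) : Sig * Sig⁻¹ = 1 :=
  Matrix.mul_nonsing_inv _ ((Matrix.isUnit_iff_isUnit_det _).1 h.isUnit)

lemma inv_mul_of_posDef (h : Sig.PosDef) : Sig⁻¹ * Sig = 1 :=
  Matrix.nonsing_inv_mul _ ((Matrix.isUnit_iff_isUnit_det _).1 h.isUnit)

lemma inv_apply_comm_of_posDef (h : Sig.PosDef) (i j : Fin p) : Sig⁻¹ i j = Sig⁻¹ j i :=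
  (isSymm_of_posDef h.inv).apply j i

lemma restrictedBound_univ {M : ℝ} (h : Sig.PosDef) (hM : matrixL1 Sig⁻¹ ≤ M) :
    RestrictedBound Sig Finset.univ M 0 := by
  intro v u _ hu
  have hu0 : u = 0 := funext fun i => hu i (Finset.mem_univ i)
  subst hu0
  have hv : v = Sig⁻¹.mulVec (Sig.mulVec v) := by
    rw [Matrix.mulVec_mulVec, inv_mul_of_posDef h, Matrix.one_mulVec]
  calc ∑ i, |v i| = ∑ i, |Sig⁻¹.mulVec (Sig.mulVec v) i| := by rw [← hv]
    _ ≤ ∑ i, ∑ j, |Sig⁻¹ i j| * |Sig.mulVec v j| :=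
        Finset.sum_le_sum fun i _ => abs_mulVec_le_sum _ _ i
    _ = ∑ j, (∑ i, |Sig⁻¹ i j|) * |Sig.mulVec v j| := by
        rw [Finset.sum_comm]
        simp only [Finset.sum_mul]
    _ ≤ ∑ j, M * |Sig.mulVec v j| := Finset.sum_le_sum fun j _ => mul_le_mul_of_nonneg_right
          ((sum_abs_col_le_matrixL1 _ j).trans hM) (abs_nonneg _)
    _ = _ := by rw [← Finset.mul_sum]; simp

lemma abs_le_of_abs_mulVec_le {M b : ℝ} (h : Sig.PosDef) (hM : matrixL1 Sig⁻¹ ≤ M)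
    {v : Fin p → ℝ} (hb : ∀ i, |Sig.mulVec v i| ≤ b) (i : Fin p) : |v i| ≤ M * b := by
  have hb0 : 0 ≤ b := (abs_nonneg _).trans (hb i)
  have hv : v = Sig⁻¹.mulVec (Sig.mulVec v) := by
    rw [Matrix.mulVec_mulVec, inv_mul_of_posDef h, Matrix.one_mulVec]
  calc |v i| = |Sig⁻¹.mulVec (Sig.mulVec v) i| := by rw [← hv]
    _ ≤ ∑ j, |Sig⁻¹ i j| * |Sig.mulVec v j| := abs_mulVec_le_sum _ _ i
    _ ≤ ∑ j, |Sig⁻¹ j i| * b := by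
        refine Finset.sum_le_sum fun j _ => ?_
        rw [inv_apply_comm_of_posDef h i j]
        exact mul_le_mul_of_nonneg_left (hb j) (abs_nonneg _)
    _ ≤ M * b := by
        rw [← Finset.sum_mul]
        exact mul_le_mul_of_nonneg_right ((sum_abs_col_le_matrixL1 _ i).trans hM) hb0

lemma abs_apply_le_one (h : Sig.PosDef) (hd : ∀ i, Sig i i = 1) (i j : Fin p) :
    |Sig i j| ≤ 1 := by
  by_cases hij : i = j
  · subst hij; simp [hd]
  have hsymm := (isSymm_of_posDef h).apply i j
  have key : ∀ c : ℝ, 0 ≤ 1 + 2 * c * Sig i j + c ^ 2 := by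
    intro c
    have := h.posSemidef.dotProduct_mulVec_nonneg (Pi.single i 1 + Pi.single j c)
    simp [Matrix.mulVec_add, add_dotProduct, dotProduct_add, hd, hsymm] at this
    nlinarith
  rw [abs_le]
  constructor
  · linarith [key 1]
  · linarith [key (-1)]

lemma one_le_inv_diag (h : Sig.PosDef) (hd : ∀ i, Sig i i = 1) (k : Fin p) :
    1 ≤ Sig⁻¹ k k := by
  have hcol : Sig.mulVec (fun i => Sig⁻¹ i k) = Pi.single k 1 := by
    ext i
    have := congrFun (congrFun (mul_inv_of_posDef h) i) k
    rw [Matrix.mul_apply] at this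
    simp only [Matrix.mulVec, dotProduct, this, Matrix.one_apply, Pi.single_apply]
  have hrow : Sig.mulVec (Pi.single k 1) ⬝ᵥ (fun i => Sig⁻¹ i k) = 1 := by
    have := congrFun hcol k
    simp only [Matrix.mulVec, dotProduct, Pi.single_eq_same] at this
    rw [Matrix.mulVec_single_one, ← this]
    exact Finset.sum_congr rfl fun i _ => by
      rw [Matrix.col_apply, (isSymm_of_posDef h).apply]
  have := h.posSemidef.dotProduct_mulVec_nonneg (Pi.single k 1 - fun i => Sig⁻¹ i k)
  simp only [Matrix.mulVec_sub, hcol, star_trivial, sub_dotProduct, dotProduct_sub] at this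
  rw [dotProduct_comm _ (Sig.mulVec _), dotProduct_comm _ (Sig.mulVec _), hrow] at this
  simp [hd] at this
  linarith

lemma one_le_matrixL1_inv (h : Sig.PosDef) (hd : ∀ i, Sig i i = 1) (k : Fin p) :
    1 ≤ matrixL1 Sig⁻¹ := by
  refine (one_le_inv_diag h hd k).trans ((le_abs_self _).trans ?_)
  exact (Finset.single_le_sum (f := fun i => |Sig⁻¹ i k|) (fun i _ => abs_nonneg _)
    (Finset.mem_univ k)).trans (sum_abs_col_le_matrixL1 _ k)

lemma activeEigMin_nonneg (h : Sig.PosDef) : 0 ≤ activeEigMin Sig := by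
  refine Real.iInf_nonneg fun k => Real.sInf_nonneg fun x hx => ?_
  have hp : (sub Sig (activeSet' Sig⁻¹ k) (activeSet' Sig⁻¹ k)).PosSemidef :=
    h.posSemidef.submatrix _
  rw [hp.isHermitian.spectrum_real_eq_range_eigenvalues] at hx
  obtain ⟨i, rfl⟩ := hx
  exact hp.eigenvalues_nonneg i

end Covariance

/-! ### The matrix programs -/

section Programs

variable {p : ℕ}

lemma isClime_iff_isAdaptiveClime_one {R T : Matrix (Fin p) (Fin p) ℝ} {lam : ℝ} :
    IsClime R lam T ↔ IsAdaptiveClime R (Matrix.of fun _ _ => 1) lam T := by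
  simp [IsClime, IsAdaptiveClime, entryL1]

lemma mul_apply_eq_mulVec (R T : Matrix (Fin p) (Fin p) ℝ) (i k : Fin p) :
    (R * T - 1) i k = R.mulVec (fun j => T j k) i - (Pi.single k 1 : Fin p → ℝ) i := by
  rw [Matrix.sub_apply, Matrix.mul_apply, Matrix.one_apply, Pi.single_apply]
  rfl

lemma IsAdaptiveClime.isColumnOpt {R W T : Matrix (Fin p) (Fin p) ℝ} {lam : ℝ}
    (hW : ∀ i j, 0 ≤ W i j) (h : IsAdaptiveClime R W lam T) (k : Fin p) :
    IsColumnOpt R (fun i => W i k) lam (Pi.single k 1) fun i => T i k := by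
  refine ⟨fun i => by simpa only [mul_apply_eq_mulVec] using h.1 i k, fun t ht => ?_⟩
  have hopt := h.2 (T.updateCol k t) fun i j => by
    rw [mul_apply_eq_mulVec]
    by_cases hj : j = k
    · subst hj
      simpa using ht i
    · simpa only [Matrix.updateCol_ne hj, mul_apply_eq_mulVec] using h.1 i j
  have hsplit : ∀ A : Matrix (Fin p) (Fin p) ℝ,
      entryL1 A = ∑ i, |A i k| + ∑ j ∈ Finset.univ.erase k, ∑ i, |A i j| := fun A => by
    exact Finset.sum_comm.trans
      (Finset.add_sum_erase Finset.univ (fun j => ∑ i, |A i j|) (Finset.mem_univ k)).symm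
  rw [hsplit, hsplit] at hopt
  have he : ∑ j ∈ Finset.univ.erase k, ∑ i, |(W.hadamard (T.updateCol k t)) i j| =
      ∑ j ∈ Finset.univ.erase k, ∑ i, |(W.hadamard T) i j| := by
    refine Finset.sum_congr rfl fun j hj => Finset.sum_congr rfl fun i _ => ?_
    rw [Matrix.hadamard_apply, Matrix.hadamard_apply,
      Matrix.updateCol_ne (Finset.ne_of_mem_erase hj)]
  rw [he, add_le_add_iff_right] at hopt
  simpa [Matrix.hadamard_apply, abs_mul, abs_of_nonneg (hW _ _)] using hopt

lemma exists_isAdaptiveClime {R W : Matrix (Fin p) (Fin p) ℝ} {lam : ℝ} (hW : ∀ i j, 0 < W i j)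
    (hfeas : ∃ T₀ : Matrix (Fin p) (Fin p) ℝ, ∀ i j, |(R * T₀ - 1) i j| ≤ lam * W i j) :
    ∃ T, IsAdaptiveClime R W lam T := by
  obtain ⟨T₀, hT₀⟩ := hfeas
  have hcont : Continuous fun T : Matrix (Fin p) (Fin p) ℝ => entryL1 (W.hadamard T) := by
    unfold entryL1
    simp only [Matrix.hadamard_apply]
    fun_prop
  set B : ℝ := entryL1 (W.hadamard T₀) with hB
  set K : Set (Matrix (Fin p) (Fin p) ℝ) :=
    {T | (∀ i j, |(R * T - 1) i j| ≤ lam * W i j) ∧ entryL1 (W.hadamard T) ≤ B} with hK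
  have hclosed : IsClosed K := by
    refine IsClosed.and ?_ (isClosed_le hcont continuous_const)
    simp only [Set.ofPred_forall]
    refine isClosed_iInter fun i => isClosed_iInter fun j => isClosed_le ?_ continuous_const
    have : Continuous fun T : Matrix (Fin p) (Fin p) ℝ => R * T - 1 := by fun_prop
    exact (this.matrix_elem i j).abs
  have hsub : K ⊆ Set.pi Set.univ fun i : Fin p => Set.pi Set.univ fun j : Fin p =>
      Set.Icc (-(B / W i j)) (B / W i j) := by
    intro T hT i _ j _
    refine Set.mem_Icc.2 (abs_le.1 ?_)
    rw [le_div_iff₀ (hW i j)]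
    refine le_trans ?_ hT.2
    have e : |T i j| * W i j = |(W.hadamard T) i j| := by
      rw [Matrix.hadamard_apply, abs_mul, abs_of_pos (hW i j), mul_comm]
    rw [e]
    refine le_trans ?_ (Finset.single_le_sum (f := fun i => ∑ j, |(W.hadamard T) i j|)
      (fun i _ => Finset.sum_nonneg fun j _ => abs_nonneg _) (Finset.mem_univ i))
    exact Finset.single_le_sum (f := fun j => |(W.hadamard T) i j|)
      (fun j _ => abs_nonneg _) (Finset.mem_univ j)
  have hcompact : IsCompact K :=
    (isCompact_univ_pi fun i => isCompact_univ_pi fun j => isCompact_Icc).of_isClosed_subset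
      hclosed hsub
  obtain ⟨T, hT, hmin⟩ := hcompact.exists_isMinOn ⟨T₀, hT₀, le_rfl⟩ hcont.continuousOn
  refine ⟨T, hT.1, fun T' hT' => ?_⟩
  by_cases hle : entryL1 (W.hadamard T') ≤ B
  · exact hmin ⟨hT', hle⟩
  · exact hT.2.trans (not_le.1 hle).le

end Programs

/-! ### The two-stage procedure on a good event -/

section Deterministic

variable {p : ℕ} {Sig R : Matrix (Fin p) (Fin p) ℝ}

lemma mulVec_inv_col (h : Sig.PosDef) (k : Fin p) :
    Sig.mulVec (fun i => Sig⁻¹ i k) = Pi.single k 1 := by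
  ext i
  have := mul_apply_eq_mulVec Sig Sig⁻¹ i k
  rw [mul_inv_of_posDef h] at this
  simp only [sub_self, Matrix.zero_apply] at this
  linarith

/-- The maximal entrywise error of the CLIME. -/
lemma IsClime.abs_sub_inv_le {T T₀ : Matrix (Fin p) (Fin p) ℝ} {M δ lam : ℝ} (hT : IsClime R lam T)
    (h : Sig.PosDef) (hM : matrixL1 Sig⁻¹ ≤ M) (hδ : ∀ i j, |R i j - Sig i j| ≤ δ)
    (hT₀ : ∀ i j, |(R * T₀ - 1) i j| ≤ lam) (hT₀M : ∀ k, ∑ i, |T₀ i k| ≤ 2 * M) (i k : Fin p) :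
    |T i k - Sig⁻¹ i k| ≤ M * (lam + δ * (2 * M)) := by
  have hδ0 : 0 ≤ δ := (abs_nonneg _).trans (hδ i i)
  have hcol := (isClime_iff_isAdaptiveClime_one.1 hT).isColumnOpt (by simp) k
  have hsum : ∑ i, |T i k| ≤ 2 * M := by
    have := hcol.2 (fun i => T₀ i k) fun i => by
      simpa only [mul_apply_eq_mulVec, Matrix.of_apply, mul_one] using hT₀ i k
    simp only [Matrix.of_apply, one_mul] at this
    exact this.trans (hT₀M k)
  refine abs_le_of_abs_mulVec_le h hM (v := (fun i => T i k) - fun i => Sig⁻¹ i k) (fun l => ?_) i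
  rw [Matrix.mulVec_sub, Pi.sub_apply, mulVec_inv_col h]
  have h1 := hcol.1 l
  simp only [Matrix.of_apply, mul_one] at h1
  have h2 := abs_mulVec_sub_mulVec_le hδ (fun i => T i k) l
  have h3 : δ * ∑ j, |T j k| ≤ δ * (2 * M) := mul_le_mul_of_nonneg_left hsum hδ0
  have e : Sig.mulVec (fun i => T i k) l - (Pi.single k 1 : Fin p → ℝ) l =
      (R.mulVec (fun i => T i k) l - (Pi.single k 1 : Fin p → ℝ) l) -
        (R.mulVec (fun i => T i k) l - Sig.mulVec (fun i => T i k) l) := by ring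
  rw [e]
  exact (abs_sub _ _).trans (by linarith)

lemma mem_activeSet'_self (T : Matrix (Fin p) (Fin p) ℝ) (k : Fin p) : k ∈ activeSet' T k :=
  Finset.mem_insert_self _ _

lemma inv_eq_zero_of_notMem_activeSet' (h : Sig.PosDef) {i k : Fin p}
    (hi : i ∉ activeSet' Sig⁻¹ k) : Sig⁻¹ i k = 0 := by
  by_contra hne
  refine hi (Finset.mem_insert.2 ?_)
  by_cases hik : i = k
  · exact Or.inl hik
  · refine Or.inr (Finset.mem_filter.2 ⟨Finset.mem_univ _, hik, ?_⟩)
    rwa [inv_apply_comm_of_posDef h]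

lemma psiMin_le {T : Matrix (Fin p) (Fin p) ℝ} {i j : Fin p} (hij : i ≠ j) (h : T i j ≠ 0) :
    psiMin T ≤ |T i j| :=
  ciInf_le (f := fun e : offSupport T => |T e.1.1 e.1.2|) (Set.finite_range _).bddBelow
    ⟨(i, j), hij, h⟩

lemma card_activeSet'_le (T : Matrix (Fin p) (Fin p) ℝ) (k : Fin p) :
    ((activeSet' T k).card : ℝ) ≤ maxDegree T + 1 := by
  have h1 : (activeSet' T k).card ≤ (activeSet T k).card + 1 := Finset.card_insert_le _ _
  have h2 : (activeSet T k).card ≤ maxDegree T :=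
    Finset.le_sup (f := fun k => (activeSet T k).card) (Finset.mem_univ k)
  exact_mod_cast h1.trans (Nat.succ_le_succ h2)

lemma sign_eq_of_abs_sub_lt {a b : ℝ} (h : |a - b| < |b|) : SignType.sign a = SignType.sign b := by
  rcases lt_trichotomy b 0 with hb | hb | hb
  · rw [abs_of_neg hb, abs_lt] at h
    rw [sign_neg hb, sign_neg (by linarith)]
  · simp [hb] at h
    exact absurd h (not_lt.2 (abs_nonneg a))
  · rw [abs_of_pos hb, abs_lt] at h
    rw [sign_pos hb, sign_pos (by linarith)]

/-- The two-stage procedure succeeds if `R` is within `δ` of `Sig`, a feasible point of the first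
program is available, and the tuning parameters are in the right ranges. -/
theorem adaptiveClimeSucceeds_of_close {n : ℕ} (hn : 1 ≤ n)
    {T₀ : Matrix (Fin p) (Fin p) ℝ} {G H M ψ δ ν lamc lamac : ℝ}
    (h : Sig.PosDef) (hd : ∀ i, Sig i i = 1)
    (hG : ∀ k, tildeG Sig k ≤ G) (hG1 : 1 ≤ G) (hH : ∀ k, tildeH Sig k ≤ H) (hH1 : 1 ≤ H)
    (hM : matrixL1 Sig⁻¹ ≤ M) (hM1 : 1 ≤ M)
    (hψ : ψ ≤ psiMin Sig⁻¹) (hψ0 : 0 < ψ) (hψ1 : ψ ≤ 1)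
    (hδ : ∀ i j, |R i j - Sig i j| ≤ δ) (hδ1 : δ ≤ 1)
    (hGδ : G * ((maxDegree Sig⁻¹ + 1) * δ) ≤ 1 / 2)
    (hT₀ : ∀ i j, |(R * T₀ - 1) i j| ≤ lamc) (hT₀M : ∀ k, ∑ i, |T₀ i k| ≤ 2 * M)
    (hlam : 0 ≤ lamac)
    (hη : M * (lamc + δ * (2 * M)) ≤ ψ / 2)
    (hν : M * (lamc + δ * (2 * M)) + 1 / n ≤ ν)
    (hν1 : 2 / ψ * (2 * H + 1) * ν < 1)
    (hν2 : 2 * (2 * G * (2 / ψ) * (M + 2) + 2 * G) * ν ≤ lamac)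
    (hψ2 : G * ((maxDegree Sig⁻¹ + 1) *
      (lamac * (2 / ψ) + δ * (2 * G * (2 / ψ) * (M + 2)))) < ψ) :
    AdaptiveClimeSucceeds n R Sig⁻¹ lamc lamac := by
  have hn0 : (0 : ℝ) < 1 / n := by positivity
  have hn1 : (1 : ℝ) / n ≤ 1 := by
    rw [div_le_one (by positivity)]
    exact_mod_cast hn
  refine ⟨?_, fun T hT => ?_⟩
  · obtain ⟨T, hT⟩ := exists_isAdaptiveClime (R := R) (W := Matrix.of fun _ _ => 1) (lam := lamc)
      (by simp) ⟨T₀, by simpa using hT₀⟩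
    exact ⟨T, isClime_iff_isAdaptiveClime_one.2 hT⟩
  have hTΘ := hT.abs_sub_inv_le h hM hδ hT₀ hT₀M
  set W := climeWeight n T with hWdef
  have hWpos : ∀ i j, 0 < W i j := fun i j => by
    simp only [hWdef, climeWeight, Matrix.of_apply]
    positivity
  have hWl : ∀ {i j} {c : ℝ}, |T i j| + 1 / n ≤ c → c⁻¹ ≤ W i j := fun {i j c} hc => by
    simp only [hWdef, climeWeight, Matrix.of_apply]
    exact inv_anti₀ (by positivity) hc
  have hδ0 : ∀ _ : Fin p, 0 ≤ δ := fun i => (abs_nonneg _).trans (hδ i i)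
  have hR2 : ∀ i j, |R i j| ≤ 2 := fun i j => by
    have h1 := hδ i j
    have h2 := abs_apply_le_one h hd i j
    have := abs_sub_abs_le_abs_sub (R i j) (Sig i j)
    linarith
  have hRB : ∀ k, RestrictedBound R (activeSet' Sig⁻¹ k) (2 * G) (2 * H + 1) := fun k => by
    refine (restrictedBound_activeSet' h k (hG k) (hH k)).perturb (by linarith) hδ ?_
    refine le_trans (mul_le_mul_of_nonneg_left ?_ (by linarith)) hGδ
    exact mul_le_mul_of_nonneg_right (card_activeSet'_le _ k) (hδ0 k)
  have hΘψ : ∀ {i k}, i ∈ activeSet' Sig⁻¹ k → ψ ≤ |Sig⁻¹ i k| := by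
    intro i k hi
    rcases Finset.mem_insert.1 hi with rfl | hi
    · exact hψ1.trans ((one_le_inv_diag h hd i).trans (le_abs_self _))
    · obtain ⟨-, hik, hne⟩ := Finset.mem_filter.1 hi
      rw [inv_apply_comm_of_posDef h]
      exact hψ.trans (psiMin_le hik.symm hne)
  have hΘM : ∀ i k, |Sig⁻¹ i k| ≤ M := fun i k =>
    (Finset.single_le_sum (f := fun i => |Sig⁻¹ i k|) (fun i _ => abs_nonneg _)
      (Finset.mem_univ i)).trans ((sum_abs_col_le_matrixL1 _ k).trans hM)
  have hw₀ : ∀ k, ∀ i ∈ activeSet' Sig⁻¹ k, (M + 2)⁻¹ ≤ W i k := fun k i _ => by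
    refine hWl ?_
    have := abs_sub_abs_le_abs_sub (T i k) (Sig⁻¹ i k)
    linarith [hTΘ i k, hΘM i k]
  have hw₁ : ∀ k, ∀ i ∈ activeSet' Sig⁻¹ k, W i k ≤ 2 / ψ := fun k i hi => by
    have h1 := abs_sub_abs_le_abs_sub (Sig⁻¹ i k) (T i k)
    rw [abs_sub_comm] at h1
    have h2 : ψ / 2 ≤ |T i k| + 1 / n := by linarith [hTΘ i k, hΘψ hi]
    simp only [hWdef, climeWeight, Matrix.of_apply]
    rw [← inv_div ψ 2]
    exact inv_anti₀ (by positivity) h2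
  have hwν : ∀ k, ∀ i ∉ activeSet' Sig⁻¹ k, ν⁻¹ ≤ W i k := fun k i hi => by
    have := hTΘ i k
    rw [inv_eq_zero_of_notMem_activeSet' h hi, sub_zero] at this
    exact hWl (by linarith)
  have hq : 0 < 2 * G * (2 / ψ) * (M + 2) := by positivity
  have hlamν : ∀ _ : Fin p, 2 * (2 * G * (2 / ψ) * (M + 2) + 2 * G) ≤ lamac * ν⁻¹ ∧
      2 / ψ * (2 * H + 1) < ν⁻¹ := fun i => by
    have hν0 : 0 < ν := lt_of_lt_of_le (add_pos_of_nonneg_of_pos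
      ((abs_nonneg _).trans (hTΘ i i)) hn0) hν
    rw [← div_eq_mul_inv, le_div_iff₀ hν0, lt_inv_comm₀ (by positivity) hν0, lt_inv_comm₀ hν0
      (by positivity)]
    refine ⟨hν2, ?_⟩
    rwa [← one_div, lt_div_iff₀ hν0]
  refine ⟨exists_isAdaptiveClime hWpos ?_, fun U hU => ?_⟩
  · have : ∀ k, ∃ t : Fin p → ℝ,
        ∀ i, |R.mulVec t i - (Pi.single k 1 : Fin p → ℝ) i| ≤ lamac * W i k := fun k => by
      obtain ⟨t, -, -, ht⟩ := exists_feasible_column (mem_activeSet'_self Sig⁻¹ k) (hRB k) hR2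
        hlam (fun i => (hWpos i k).le) (hwν k) (by linarith [(hlamν k).1])
      exact ⟨t, ht⟩
    choose t ht using this
    exact ⟨Matrix.of fun i k => t k i, fun i k => by
      rw [mul_apply_eq_mulVec]
      exact ht k i⟩
  have hcol : ∀ k, (∀ i ∉ activeSet' Sig⁻¹ k, U i k = 0) ∧
      ∑ i, |U i k| ≤ 2 * G * (2 / ψ) * (M + 2) := fun k => by
    have := (hU.isColumnOpt (fun i j => (hWpos i j).le) k).eq_zero_of_notMem
      (mem_activeSet'_self Sig⁻¹ k) (hRB k) (by linarith) (by linarith) hR2 hlam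
      (inv_pos.2 (by linarith : 0 < M + 2)) (hw₀ k) (hw₁ k) (hwν k) (hlamν k).2
      (by rw [div_inv_eq_mul]; exact (hlamν k).1)
    rwa [div_inv_eq_mul] at this
  have herr : ∀ i k, |U i k - Sig⁻¹ i k| < ψ := fun i k => by
    have hsupp : ∀ i ∉ activeSet' Sig⁻¹ k, U i k - Sig⁻¹ i k = 0 := fun i hi => by
      rw [(hcol k).1 i hi, inv_eq_zero_of_notMem_activeSet' h hi, sub_zero]
    have h1 := (restrictedBound_activeSet' h k (hG k) (hH k)).sum_abs_le
      (v := (fun i => U i k) - fun i => Sig⁻¹ i k) hsupp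
    have h2 : ∀ l ∈ activeSet' Sig⁻¹ k,
        |Sig.mulVec ((fun i => U i k) - fun i => Sig⁻¹ i k) l| ≤
          lamac * (2 / ψ) + δ * (2 * G * (2 / ψ) * (M + 2)) := fun l hl => by
      rw [Matrix.mulVec_sub, Pi.sub_apply, mulVec_inv_col h]
      have e1 := (hU.isColumnOpt (fun i j => (hWpos i j).le) k).1 l
      have e2 := abs_mulVec_sub_mulVec_le hδ (fun i => U i k) l
      have e3 := mul_le_mul_of_nonneg_left (hcol k).2 (hδ0 k)
      have e4 := mul_le_mul_of_nonneg_left (hw₁ k l hl) hlam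
      have e : Sig.mulVec (fun i => U i k) l - (Pi.single k 1 : Fin p → ℝ) l =
          (R.mulVec (fun i => U i k) l - (Pi.single k 1 : Fin p → ℝ) l) -
            (R.mulVec (fun i => U i k) l - Sig.mulVec (fun i => U i k) l) := by ring
      rw [e]
      exact (abs_sub _ _).trans (by linarith)
    have h3 := Finset.sum_le_sum h2
    rw [Finset.sum_const, nsmul_eq_mul] at h3
    have h4 : |U i k - Sig⁻¹ i k| ≤ ∑ i, |U i k - Sig⁻¹ i k| :=
      Finset.single_le_sum (f := fun i => |U i k - Sig⁻¹ i k|) (fun i _ => abs_nonneg _)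
        (Finset.mem_univ i)
    refine lt_of_le_of_lt (h4.trans (h1.trans ?_)) hψ2
    refine mul_le_mul_of_nonneg_left (h3.trans ?_) (by linarith)
    have := hδ0 k
    exact mul_le_mul_of_nonneg_right (card_activeSet'_le _ k) (by positivity)
  refine ⟨fun i j hij => sign_eq_of_abs_sub_lt ?_, fun i j hij hnot => ?_⟩
  · exact (herr i j).trans_le (hψ.trans (psiMin_le hij.1 hij.2))
  · have h0 : Sig⁻¹ i j = 0 := by
      by_contra hne
      exact hnot ⟨hij, hne⟩
    rw [(hcol j).1 i, sign_zero]
    intro hmem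
    have := hΘψ hmem
    rw [h0, abs_zero] at this
    linarith

/-- The inverse of the population matrix is feasible for the first program. -/
lemma inv_feasible {M δ lamc : ℝ} (h : Sig.PosDef) (hM : matrixL1 Sig⁻¹ = M)
    (hδ : ∀ i j, |R i j - Sig i j| ≤ δ) (hlam : M * δ ≤ lamc) (i k : Fin p) :
    |(R * Sig⁻¹ - 1) i k| ≤ lamc := by
  rw [mul_apply_eq_mulVec, ← mulVec_inv_col h]
  refine (abs_mulVec_sub_mulVec_le hδ _ i).trans (le_trans ?_ hlam)
  rw [mul_comm]
  exact mul_le_mul_of_nonneg_right (hM ▸ sum_abs_col_le_matrixL1 _ k)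
    ((abs_nonneg _).trans (hδ i i))

/-- If `R` is so close to `Sig` that it is invertible, its inverse is feasible. -/
lemma exists_rightInverse {M δ : ℝ} (h : Sig.PosDef) (hM : matrixL1 Sig⁻¹ ≤ M) (hM0 : 0 ≤ M)
    (hδ : ∀ i j, |R i j - Sig i j| ≤ δ) (hp : M * (p * δ) ≤ 1 / 2) :
    ∃ T₀ : Matrix (Fin p) (Fin p) ℝ, R * T₀ = 1 ∧ ∀ k, ∑ i, |T₀ i k| ≤ 2 * M := by
  have hRB := (restrictedBound_univ h hM).perturb hM0 hδ (by simpa using hp)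
  have : ∀ k, ∃ t : Fin p → ℝ, R.mulVec t = Pi.single k 1 := fun k => by
    obtain ⟨t, -, ht⟩ := hRB.exists_solution (Pi.single k 1)
    exact ⟨t, funext fun i => ht i (Finset.mem_univ i)⟩
  choose t ht using this
  refine ⟨Matrix.of fun i k => t k i, ?_, fun k => ?_⟩
  · rw [← sub_eq_zero]
    ext i k
    rw [mul_apply_eq_mulVec]
    simp [ht]
  · have := hRB.sum_abs_le (v := t k) (by simp)
    simp only [ht k] at this
    have e : ∑ i, |(Pi.single k 1 : Fin p → ℝ) i| = 1 := by
      rw [Finset.sum_eq_single k (fun b _ hb => by simp [hb]) (by simp)]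
      simp
    rwa [e, mul_one] at this

end Deterministic

/-! ### The sign covariance of a bivariate Gaussian vector -/

section SignCovariance

lemma measurable_realSign : Measurable Real.sign := by
  unfold Real.sign
  exact Measurable.ite measurableSet_Iio measurable_const
    (Measurable.ite measurableSet_Ioi measurable_const measurable_const)

lemma abs_realSign_le_one (x : ℝ) : |Real.sign x| ≤ 1 := by
  rcases Real.sign_apply_eq x with h | h | h <;> simp [h]

lemma realSign_mul_of_pos {c : ℝ} (hc : 0 < c) (x : ℝ) : Real.sign (c * x) = Real.sign x := by
  rcases lt_trichotomy x 0 with h | h | h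
  · rw [Real.sign_of_neg h, Real.sign_of_neg (mul_neg_of_pos_of_neg hc h)]
  · simp [h]
  · rw [Real.sign_of_pos h, Real.sign_of_pos (mul_pos hc h)]

lemma integral_sign_cos_mul_sign_sin {β : ℝ} (h₁ : -(Real.pi / 2) < β) (h₂ : β < Real.pi / 2) :
    ∫ θ in (-Real.pi)..Real.pi, Real.sign (Real.cos θ) * Real.sign (Real.sin (θ + β)) = 4 * β := by
  set h : ℝ → ℝ := fun θ => Real.sign (Real.cos θ) * Real.sign (Real.sin (θ + β)) with hh
  have hper : Function.Periodic h Real.pi := fun θ => by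
    simp only [hh]
    rw [Real.cos_add_pi, add_right_comm, Real.sin_add_pi, Real.sign_neg, Real.sign_neg]
    ring
  have hmeas : Measurable h := by
    have := measurable_realSign
    fun_prop
  have hint : ∀ a b, IntervalIntegrable h volume a b := fun a b => by
    refine (intervalIntegrable_const (c := (1 : ℝ))).mono_fun
      hmeas.aestronglyMeasurable (ae_of_all _ fun θ => ?_)
    simp only [hh, norm_mul, Real.norm_eq_abs, abs_one]
    exact mul_le_one₀ (abs_realSign_le_one _) (abs_nonneg _) (abs_realSign_le_one _)
  have hsint : ∀ a b, IntervalIntegrable (fun θ => Real.sign (Real.sin θ)) volume a b :=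
    fun a b => by
      refine (intervalIntegrable_const (c := (1 : ℝ))).mono_fun
        (measurable_realSign.comp Real.measurable_sin).aestronglyMeasurable
        (ae_of_all _ fun θ => ?_)
      simpa using abs_realSign_le_one _
  have hpi := Real.pi_pos
  have hhalf : ∫ θ in (-(Real.pi / 2))..(Real.pi / 2), h θ = 2 * β := by
    have e1 : ∫ θ in (-(Real.pi / 2))..(Real.pi / 2), h θ =
        ∫ θ in (-(Real.pi / 2))..(Real.pi / 2), Real.sign (Real.sin (θ + β)) := by
      refine intervalIntegral.integral_congr_Ioo_of_le (by linarith) fun θ hθ => ?_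
      simp only [hh]
      rw [Real.sign_of_pos (Real.cos_pos_of_mem_Ioo hθ), one_mul]
    rw [e1, intervalIntegral.integral_comp_add_right (fun θ => Real.sign (Real.sin θ)),
      ← intervalIntegral.integral_add_adjacent_intervals (hsint _ 0) (hsint 0 _)]
    have e2 : ∫ θ in (-(Real.pi / 2) + β)..0, Real.sign (Real.sin θ) =
        ∫ θ in (-(Real.pi / 2) + β)..0, (-1 : ℝ) := by
      refine intervalIntegral.integral_congr_Ioo_of_le (by linarith) fun θ hθ => ?_
      exact Real.sign_of_neg (Real.sin_neg_of_neg_of_neg_pi_lt hθ.2 (by linarith [hθ.1]))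
    have e3 : ∫ θ in (0 : ℝ)..(Real.pi / 2 + β), Real.sign (Real.sin θ) =
        ∫ θ in (0 : ℝ)..(Real.pi / 2 + β), (1 : ℝ) := by
      refine intervalIntegral.integral_congr_Ioo_of_le (by linarith) fun θ hθ => ?_
      exact Real.sign_of_pos (Real.sin_pos_of_pos_of_lt_pi hθ.1 (by linarith [hθ.2]))
    rw [e2, e3, intervalIntegral.integral_const, intervalIntegral.integral_const]
    simp only [smul_eq_mul]
    ring
  have hone : ∀ a, ∫ θ in a..(a + Real.pi), h θ = 2 * β := fun a => by
    rw [hper.intervalIntegral_add_eq a (-(Real.pi / 2)), ← hhalf]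
    congr 1
    ring
  rw [← intervalIntegral.integral_add_adjacent_intervals (hint _ 0) (hint 0 _)]
  have e1 := hone (-Real.pi)
  have e2 := hone 0
  rw [neg_add_cancel] at e1
  rw [zero_add] at e2
  rw [e1, e2]
  ring

lemma integral_gaussianReal_prod (f : ℝ × ℝ → ℝ) :
    ∫ z, f z ∂((gaussianReal 0 1).prod (gaussianReal 0 1)) =
      ∫ z : ℝ × ℝ, (2 * Real.pi)⁻¹ * Real.exp (-(z.1 ^ 2 + z.2 ^ 2) / 2) * f z := by
  rw [gaussianReal_of_var_ne_zero 0 one_ne_zero,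
    prod_withDensity (measurable_gaussianPDF 0 1) (measurable_gaussianPDF 0 1),
    ← Measure.volume_eq_prod, integral_withDensity_eq_integral_toReal_smul (by fun_prop)
      (ae_of_all _ fun z => ENNReal.mul_lt_top (by simp [gaussianPDF]) (by simp [gaussianPDF]))]
  refine integral_congr_ae (ae_of_all _ fun z => ?_)
  simp only [ENNReal.toReal_mul, toReal_gaussianPDF, gaussianPDFReal, smul_eq_mul, sub_zero,
    NNReal.coe_one, mul_one]
  congr 1
  rw [mul_mul_mul_comm, ← Real.exp_add, ← mul_inv, Real.mul_self_sqrt (by positivity)]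
  congr 2
  ring

/-- The integral of a function of the angle with respect to the standard Gaussian on the plane. -/
lemma integral_gaussianReal_prod_of_angle {f : ℝ × ℝ → ℝ} {g : ℝ → ℝ}
    (hfg : ∀ r θ, 0 < r → f (r * Real.cos θ, r * Real.sin θ) = g θ) :
    ∫ z, f z ∂((gaussianReal 0 1).prod (gaussianReal 0 1)) =
      (2 * Real.pi)⁻¹ * ∫ θ in (-Real.pi)..Real.pi, g θ := by
  have key : ∀ {f : ℝ × ℝ → ℝ} {g : ℝ → ℝ},
      (∀ r θ, 0 < r → f (r * Real.cos θ, r * Real.sin θ) = g θ) →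
      ∫ z, f z ∂((gaussianReal 0 1).prod (gaussianReal 0 1)) =
        (∫ r in Set.Ioi (0 : ℝ), r * ((2 * Real.pi)⁻¹ * Real.exp (-(r ^ 2) / 2))) *
          ∫ θ in Set.Ioo (-Real.pi) Real.pi, g θ := by
    intro f g hfg
    rw [integral_gaussianReal_prod, ← integral_comp_polarCoord_symm, polarCoord_target,
      ← setIntegral_prod_mul, ← Measure.volume_eq_prod]
    refine setIntegral_congr_fun (measurableSet_Ioi.prod measurableSet_Ioo) fun z hz => ?_
    simp only [polarCoord_symm_apply, smul_eq_mul]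
    rw [hfg z.1 z.2 hz.1]
    have : (z.1 * Real.cos z.2) ^ 2 + (z.1 * Real.sin z.2) ^ 2 = z.1 ^ 2 := by
      rw [mul_pow, mul_pow, ← mul_add, Real.cos_sq_add_sin_sq, mul_one]
    rw [this]
    ring
  have hone := key (f := fun _ => 1) (g := fun _ => 1) fun _ _ _ => rfl
  simp only [integral_const, probReal_univ, smul_eq_mul, mul_one,
    measureReal_restrict_apply_univ, Real.volume_real_Ioo] at hone
  have hpi := Real.pi_pos
  rw [sub_neg_eq_add, ← two_mul, max_eq_left (by positivity)] at hone
  rw [key hfg, intervalIntegral.integral_of_le (by linarith), integral_Ioc_eq_integral_Ioo]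
  congr 1
  exact eq_inv_of_mul_eq_one_left hone.symm

/-- **Sheppard's formula**: the sign covariance of two standard Gaussian variables with
correlation `r`. -/
theorem integral_sign_mul_sign_of_hasGaussianLaw {Ω : Type*} {mΩ : MeasurableSpace Ω}
    {P : Measure Ω} {U V : Ω → ℝ} {r : ℝ} (h : HasGaussianLaw (fun ω => (U ω, V ω)) P)
    (hU0 : ∫ ω, U ω ∂P = 0) (hV0 : ∫ ω, V ω ∂P = 0) (hU1 : Var[U; P] = 1) (hV1 : Var[V; P] = 1)
    (hr : cov[U, V; P] = r) (hr₁ : -1 < r) (hr₂ : r < 1) :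
    ∫ ω, Real.sign (U ω) * Real.sign (V ω) ∂P = 2 / Real.pi * Real.arcsin r := by
  have := h.isProbabilityMeasure
  have hU := h.fst
  have hV := h.snd
  set β := Real.arcsin r with hβ
  have hsin : Real.sin β = r := Real.sin_arcsin hr₁.le hr₂.le
  have hβ₁ : -(Real.pi / 2) < β := Real.neg_pi_div_two_lt_arcsin.2 hr₁
  have hβ₂ : β < Real.pi / 2 := Real.arcsin_lt_pi_div_two.2 hr₂
  have hcos : 0 < Real.cos β := Real.cos_pos_of_mem_Ioo ⟨hβ₁, hβ₂⟩
  set W : Ω → ℝ := fun ω => (Real.cos β)⁻¹ * (V ω - r * U ω) with hW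
  have hUW : HasGaussianLaw (fun ω => (U ω, W ω)) P := by
    have := h.map_fun ((ContinuousLinearMap.fst ℝ ℝ ℝ).prod
      ((Real.cos β)⁻¹ • (ContinuousLinearMap.snd ℝ ℝ ℝ - r • ContinuousLinearMap.fst ℝ ℝ ℝ)))
    simpa [hW] using this
  have hU2 := hU.memLp_two
  have hV2 := hV.memLp_two
  have hrU2 : MemLp (fun ω => r * U ω) 2 P := hU2.const_mul r
  have hcov : cov[U, W; P] = 0 := by
    have e : cov[U, V - fun ω => r * U ω; P] = 0 := by
      rw [covariance_sub_right hU2 hV2 hrU2, covariance_const_mul_right, hr,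
        covariance_self hU.aemeasurable, hU1]
      ring
    have e2 : cov[U, W; P] = (Real.cos β)⁻¹ * cov[U, V - fun ω => r * U ω; P] :=
      covariance_const_mul_right _
    rw [e2, e, mul_zero]
  have hWvar : Var[W; P] = 1 := by
    have e : Var[V - fun ω => r * U ω; P] = Real.cos β ^ 2 := by
      rw [variance_sub hV2 hrU2, covariance_const_mul_right, variance_const_mul, hU1, hV1,
        covariance_comm, hr, Real.cos_sq', hsin]
      ring
    have e2 : Var[W; P] = (Real.cos β)⁻¹ ^ 2 * Var[V - fun ω => r * U ω; P] :=
      variance_const_mul _ _ _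
    rw [e2, e]
    field_simp
  have hWmean : ∫ ω, W ω ∂P = 0 := by
    simp only [hW]
    rw [integral_const_mul, integral_sub hV.integrable (hU.integrable.const_mul r),
      integral_const_mul, hU0, hV0]
    simp
  have hUlaw : P.map U = gaussianReal 0 1 := by
    rw [hU.map_eq_gaussianReal, hU0, hU1, Real.toNNReal_one]
  have hWlaw : P.map W = gaussianReal 0 1 := by
    rw [hUW.snd.map_eq_gaussianReal, hWmean, hWvar, Real.toNNReal_one]
  have hlaw : P.map (fun ω => (U ω, W ω)) = (gaussianReal 0 1).prod (gaussianReal 0 1) := by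
    rw [(indepFun_iff_map_prod_eq_prod_map_map hU.aemeasurable hUW.snd.aemeasurable).1
      (hUW.indepFun_of_covariance_eq_zero hcov), hUlaw, hWlaw]
  set f : ℝ × ℝ → ℝ := fun z => Real.sign z.1 * Real.sign (r * z.1 + Real.cos β * z.2) with hf
  have hfmeas : Measurable f := by
    have := measurable_realSign
    fun_prop
  have e1 : ∫ ω, Real.sign (U ω) * Real.sign (V ω) ∂P =
      ∫ z, f z ∂(P.map fun ω => (U ω, W ω)) := by
    rw [integral_map hUW.aemeasurable hfmeas.aestronglyMeasurable]
    refine integral_congr_ae (ae_of_all _ fun ω => ?_)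
    simp only [hf, hW]
    rw [mul_inv_cancel_left₀ hcos.ne', add_sub_cancel]
  rw [e1, hlaw, integral_gaussianReal_prod_of_angle
    (g := fun θ => Real.sign (Real.cos θ) * Real.sign (Real.sin (θ + β))),
    integral_sign_cos_mul_sign_sin hβ₁ hβ₂]
  · have := Real.pi_pos
    field_simp
    ring
  · intro s θ hs
    simp only [hf]
    rw [realSign_mul_of_pos hs, ← hsin, ← realSign_mul_of_pos hs (Real.sin (θ + β)), Real.sin_add]
    congr 2
    ring

end SignCovariance

/-! ### Hoeffding's inequality for U-statistics -/

section UStatistics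

open scoped NNReal

/-- Averaging over permutations does not depend on the tuple. -/
lemma sum_perm_smul_embedding {n d : ℕ} (F : (Fin d ↪ Fin n) → ℝ) (e : Fin d ↪ Fin n) :
    (Fintype.card (Fin d ↪ Fin n) : ℝ) * ∑ σ : Equiv.Perm (Fin n), F (σ • e) =
      (n.factorial : ℝ) * ∑ t, F t := by
  have hindep : ∀ t : Fin d ↪ Fin n,
      ∑ σ : Equiv.Perm (Fin n), F (σ • t) = ∑ σ : Equiv.Perm (Fin n), F (σ • e) := fun t => by
    have := Equiv.Perm.isMultiplyPretransitive (Fin n) d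
    obtain ⟨g, rfl⟩ := MulAction.exists_smul_eq (Equiv.Perm (Fin n)) e t
    simp only [← mul_smul]
    exact Fintype.sum_equiv (Equiv.mulRight g) _ _ fun σ => rfl
  have h1 : ∑ t : Fin d ↪ Fin n, ∑ σ : Equiv.Perm (Fin n), F (σ • t) =
      (Fintype.card (Fin d ↪ Fin n) : ℝ) * ∑ σ : Equiv.Perm (Fin n), F (σ • e) := by
    rw [Finset.sum_congr rfl fun t _ => hindep t, Finset.sum_const, nsmul_eq_mul,
      Finset.card_univ]
  have h2 : ∀ σ : Equiv.Perm (Fin n), ∑ t : Fin d ↪ Fin n, F (σ • t) = ∑ t, F t := fun σ =>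
    Fintype.sum_equiv (MulAction.toPerm σ) _ _ fun t => rfl
  rw [← h1, Finset.sum_comm, Finset.sum_congr rfl fun σ _ => h2 σ, Finset.sum_const, nsmul_eq_mul,
    Finset.card_univ, Fintype.card_perm, Fintype.card_fin]

variable {Ω E : Type*} {mΩ : MeasurableSpace Ω} [MeasurableSpace E] {μ : Measure Ω}

/-- A sum of sub-Gaussian variables, not necessarily independent. -/
lemma hasSubgaussianMGF_sum {ι : Type*} [IsProbabilityMeasure μ] {X : ι → Ω → ℝ} {c : ℝ≥0}
    (s : Finset ι) (h : ∀ i ∈ s, HasSubgaussianMGF (X i) (c ^ 2) μ) :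
    HasSubgaussianMGF (fun ω => ∑ i ∈ s, X i ω) ((s.card * c) ^ 2) μ := by
  classical
  induction s using Finset.induction_on with
  | empty => simp
  | insert i s his ih =>
    simp only [Finset.sum_insert his]
    convert (h i (Finset.mem_insert_self _ _)).add
      (ih fun j hj => h j (Finset.mem_insert_of_mem hj)) using 2
    rw [NNReal.sqrt_sq, NNReal.sqrt_sq, Finset.card_insert_of_notMem his]
    push_cast
    ring

/-- The `b`-th block of `d` consecutive indices. -/
def blockEmb {n d : ℕ} (b : ℕ) (hb : d * (b + 1) ≤ n) : Fin d ↪ Fin n where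
  toFun i := ⟨d * b + i, by have := i.2; rw [mul_add] at hb; omega⟩
  inj' i j hij := by
    have := Fin.mk.inj_iff.1 hij
    exact Fin.ext (by omega)

lemma val_blockEmb {n d b : ℕ} (hb : d * (b + 1) ≤ n) (i : Fin d) :
    (blockEmb (n := n) b hb i : ℕ) = d * b + i :=
  rfl

lemma measurable_kernel_sub {Ω : Type*} {m : MeasurableSpace Ω} {d : ℕ} {F : (Fin d → E) → ℝ}
    (hF : Measurable F) (θ : ℝ) {Y : Fin d → Ω → E} (hY : ∀ i, Measurable (Y i)) :
    Measurable fun ω => F (fun i => Y i ω) - θ :=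
  (hF.comp (measurable_pi_lambda _ hY)).sub_const θ

/-- The sum of a centred bounded kernel over disjoint blocks of i.i.d. variables is
sub-Gaussian. -/
lemma hasSubgaussianMGF_sum_blocks [IsProbabilityMeasure μ] {n d m : ℕ} {Z : Fin n → Ω → E}
    (hZ : ∀ i, Measurable (Z i)) (hind : iIndepFun Z μ) {F : (Fin d → E) → ℝ}
    (hF : Measurable F) (hF1 : ∀ z, F z ∈ Set.Icc (-1 : ℝ) 1) {θ : ℝ}
    (hθ : ∀ t : Fin d ↪ Fin n, ∫ ω, F (fun i => Z (t i) ω) ∂μ = θ)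
    (hm : d * m ≤ n) (σ : Equiv.Perm (Fin n)) :
    HasSubgaussianMGF (fun ω => ∑ b : Fin m,
      (F (fun i => Z ((σ • blockEmb (d := d) b
        ((Nat.mul_le_mul_left d b.2).trans hm) : Fin d ↪ Fin n) i) ω) - θ)) m μ := by
  induction m with
  | zero => simp
  | succ m ih =>
    have ih' := ih ((Nat.mul_le_mul_left d m.le_succ).trans hm)
    simp only [Fin.sum_univ_castSucc]
    push_cast
    refine ih'.add_of_indepFun ?_ ?_
    · have hmeas : Measurable fun ω => F fun i =>
          Z ((σ • blockEmb (d := d) m hm : Fin d ↪ Fin n) i) ω :=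
        hF.comp (measurable_pi_lambda _ fun i => hZ _)
      have := hasSubgaussianMGF_of_mem_Icc (μ := μ) hmeas.aemeasurable
        (ae_of_all _ fun ω => hF1 _)
      rw [hθ] at this
      convert this using 1
      ext
      norm_num
    · set S : Set (Fin n) := {j | ∃ i : Fin n, (i : ℕ) < d * m ∧ σ i = j} with hS
      set T : Set (Fin n) := {j | ∃ i : Fin n, d * m ≤ (i : ℕ) ∧ σ i = j} with hT
      have hST : Disjoint S T := by
        rw [Set.disjoint_left]
        rintro j ⟨i, hi, rfl⟩ ⟨i', hi', h⟩
        rw [σ.injective h] at hi'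
        omega
      have hI := indep_iSup_of_disjoint (fun i => (hZ i).comap_le) hind.iIndep hST
      have hle : ∀ (A : Set (Fin n)) (j : Fin n), j ∈ A →
          Measurable[⨆ i ∈ A, MeasurableSpace.comap (Z i) inferInstance] (Z j) := fun A j hj =>
        (comap_measurable (Z j)).mono (le_iSup₂_of_le j hj le_rfl) le_rfl
      refine indep_of_indep_of_le_left (indep_of_indep_of_le_right hI ?_) ?_
      · refine Measurable.comap_le ?_
        refine measurable_kernel_sub hF θ fun i => hle T _ ?_
        exact ⟨_, by rw [val_blockEmb]; omega, rfl⟩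
      · refine Measurable.comap_le ?_
        refine Finset.measurable_sum _ fun b _ =>
          measurable_kernel_sub hF θ fun i => hle S _ ?_
        refine ⟨_, ?_, rfl⟩
        have h1 := i.2
        have h2 : d * (b + 1) ≤ d * m := Nat.mul_le_mul_left d b.2
        rw [mul_add] at h2
        rw [val_blockEmb]
        omega

/-- **Hoeffding's inequality for U-statistics** with a kernel of `d` arguments. -/
theorem measure_uStatistic_ge_le [IsProbabilityMeasure μ] {n d m : ℕ} {Z : Fin n → Ω → E}
    (hZ : ∀ i, Measurable (Z i)) (hind : iIndepFun Z μ) {F : (Fin d → E) → ℝ}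
    (hF : Measurable F) (hF1 : ∀ z, F z ∈ Set.Icc (-1 : ℝ) 1) {θ : ℝ}
    (hθ : ∀ t : Fin d ↪ Fin n, ∫ ω, F (fun i => Z (t i) ω) ∂μ = θ)
    (hm : d * m ≤ n) (hm0 : 0 < m) {ε : ℝ} (hε : 0 ≤ ε) :
    μ.real {ω | Fintype.card (Fin d ↪ Fin n) * ε ≤
      ∑ t : Fin d ↪ Fin n, (F (fun i => Z (t i) ω) - θ)} ≤ Real.exp (-(m * ε ^ 2 / 2)) := by
  have hsub := hasSubgaussianMGF_sum (μ := μ) (c := NNReal.sqrt m) Finset.univ fun σ _ => by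
    rw [NNReal.sq_sqrt]
    exact hasSubgaussianMGF_sum_blocks hZ hind hF hF1 hθ hm σ
  have hmR : (0 : ℝ) < m := by exact_mod_cast hm0
  have hfac : (0 : ℝ) < n.factorial := by exact_mod_cast n.factorial_pos
  have htail := hsub.measure_ge_le (ε := n.factorial * m * ε) (by positivity)
  have hcard : (0 : ℝ) < Fintype.card (Fin d ↪ Fin n) := by
    have : Nonempty (Fin d ↪ Fin n) :=
      ⟨blockEmb (d := d) 0 ((Nat.mul_le_mul_left d hm0).trans hm)⟩
    exact_mod_cast Fintype.card_pos
  have hsum : ∀ ω, (Fintype.card (Fin d ↪ Fin n) : ℝ) * ∑ σ : Equiv.Perm (Fin n), ∑ b : Fin m,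
      (F (fun i => Z ((σ • blockEmb (d := d) b
        ((Nat.mul_le_mul_left d b.2).trans hm) : Fin d ↪ Fin n) i) ω) - θ) =
      m * (n.factorial * ∑ t : Fin d ↪ Fin n, (F (fun i => Z (t i) ω) - θ)) := fun ω => by
    rw [Finset.sum_comm, Finset.mul_sum, Finset.sum_congr rfl fun b _ =>
      sum_perm_smul_embedding (fun t => F (fun i => Z (t i) ω) - θ) _]
    simp
  refine le_trans (measureReal_mono fun ω hω => ?_) (htail.trans (le_of_eq ?_))
  · refine le_of_mul_le_mul_left ?_ hcard
    rw [hsum]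
    have := mul_le_mul_of_nonneg_left hω (mul_pos hmR hfac).le
    linarith
  · congr 1
    simp only [Finset.card_univ, Fintype.card_perm, Fintype.card_fin]
    push_cast
    rw [mul_pow (n.factorial : ℝ), Real.sq_sqrt hmR.le]
    field_simp

end UStatistics

/-! ### Gaussian samples -/

section GaussianSample

variable {Ω : Type*} {mΩ : MeasurableSpace Ω} {μ : Measure Ω} {n p : ℕ}
  {Sig : Matrix (Fin p) (Fin p) ℝ} {Y : Fin n → Ω → EuclideanSpace ℝ (Fin p)}

lemma hasGaussianLaw_pair [IsProbabilityMeasure μ]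
    (hlaw : ∀ a, μ.map (Y a) = multivariateGaussian 0 Sig) (hind : iIndepFun Y μ) (a b c : Fin n)
    (i j : Fin p) (s : ℝ) :
    HasGaussianLaw (fun ω => (s * (Y a ω i - Y b ω i), s * (Y a ω j - Y c ω j))) μ := by
  have h : HasGaussianLaw (fun ω a => Y a ω) μ := hind.hasGaussianLaw fun a =>
    ⟨by rw [hlaw a]; infer_instance⟩
  have e : ∀ (a : Fin n) (i : Fin p), ∃ L : (Fin n → EuclideanSpace ℝ (Fin p)) →L[ℝ] ℝ,
      ∀ y, L y = y a i := fun a i =>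
    ⟨(EuclideanSpace.proj i).comp (ContinuousLinearMap.proj a), fun y => rfl⟩
  obtain ⟨La, hLa⟩ := e a i
  obtain ⟨Lb, hLb⟩ := e b i
  obtain ⟨Lc, hLc⟩ := e a j
  obtain ⟨Ld, hLd⟩ := e c j
  simpa [hLa, hLb, hLc, hLd] using h.map_fun ((s • (La - Lb)).prod (s • (Lc - Ld)))

lemma memLp_two_coord
    (hlaw : ∀ a, μ.map (Y a) = multivariateGaussian 0 Sig) (a : Fin n) (i : Fin p) :
    MemLp (fun ω => Y a ω i) 2 μ := by
  have h : HasGaussianLaw (Y a) μ := ⟨by rw [hlaw a]; infer_instance⟩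
  exact (h.map_fun (EuclideanSpace.proj i)).memLp_two

lemma integral_coord (hY : ∀ a, Measurable (Y a))
    (hlaw : ∀ a, μ.map (Y a) = multivariateGaussian 0 Sig) (hS : Sig.PosSemidef)
    (a : Fin n) (i : Fin p) : ∫ ω, Y a ω i ∂μ = 0 := by
  have h1 : ∫ ω, Y a ω i ∂μ = ∫ y, y i ∂(μ.map (Y a)) := by
    rw [integral_map (hY a).aemeasurable (by fun_prop)]
  have h2 := (measurePreserving_eval_multivariateGaussian (μ := 0) hS (i := i))
  have h3 : ∫ y, y i ∂(multivariateGaussian 0 Sig) =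
      ∫ x, x ∂((multivariateGaussian 0 Sig).map fun y => y i) := by
    rw [integral_map h2.measurable.aemeasurable (by fun_prop)]
  rw [h1, hlaw, h3, h2.map_eq, integral_id_gaussianReal]
  simp

lemma covariance_coord [IsProbabilityMeasure μ] (hY : ∀ a, Measurable (Y a))
    (hlaw : ∀ a, μ.map (Y a) = multivariateGaussian 0 Sig) (hind : iIndepFun Y μ)
    (hS : Sig.PosSemidef) (a b : Fin n) (i j : Fin p) :
    cov[fun ω => Y a ω i, fun ω => Y b ω j; μ] = if a = b then Sig i j else 0 := by
  split_ifs with hab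
  · subst hab
    rw [← covariance_eval_multivariateGaussian (μ := 0) hS i j, ← hlaw a,
      covariance_map_fun (by fun_prop) (by fun_prop) (hY a).aemeasurable]
  · refine IndepFun.covariance_eq_zero ?_ (memLp_two_coord hlaw a i)
      (memLp_two_coord hlaw b j)
    exact (hind.indepFun hab).comp (φ := fun y => y i) (ψ := fun y => y j) (by fun_prop)
      (by fun_prop)

lemma covariance_diff [IsProbabilityMeasure μ] (hY : ∀ a, Measurable (Y a))
    (hlaw : ∀ a, μ.map (Y a) = multivariateGaussian 0 Sig) (hind : iIndepFun Y μ)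
    (hS : Sig.PosSemidef) {a b c : Fin n} (hab : a ≠ b) (hac : a ≠ c) (i j : Fin p) (s : ℝ) :
    cov[fun ω => s * (Y a ω i - Y b ω i), fun ω => s * (Y a ω j - Y c ω j); μ] =
      s ^ 2 * (Sig i j + if b = c then Sig i j else 0) := by
  have hL := memLp_two_coord hlaw
  have hcov := covariance_coord hY hlaw hind hS
  rw [covariance_const_mul_left, covariance_const_mul_right]
  have e : cov[fun ω => Y a ω i - Y b ω i, fun ω => Y a ω j - Y c ω j; μ] =
      Sig i j + if b = c then Sig i j else 0 := by
    have h1 := covariance_sub_left (hL a i) (hL b i) ((hL a j).sub (hL c j))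
    rw [covariance_sub_right (hL a i) (hL a j) (hL c j),
      covariance_sub_right (hL b i) (hL a j) (hL c j), hcov, hcov, hcov, hcov, if_pos rfl,
      if_neg hac, if_neg hab.symm] at h1
    exact h1.trans (by ring)
  rw [e]
  ring

/-- There are almost surely no ties in a Gaussian sample. -/
lemma ae_ne_of_gaussian [IsProbabilityMeasure μ] (hY : ∀ a, Measurable (Y a))
    (hlaw : ∀ a, μ.map (Y a) = multivariateGaussian 0 Sig) (hind : iIndepFun Y μ)
    (hS : Sig.PosSemidef) (hd : ∀ i, Sig i i = 1) :
    ∀ᵐ ω ∂μ, ∀ (i : Fin p) (a b : Fin n), a ≠ b → Y a ω i ≠ Y b ω i := by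
  rw [ae_all_iff]
  intro i
  rw [ae_all_iff]
  intro a
  rw [ae_all_iff]
  intro b
  by_cases hab : a = b
  · simp [hab]
  have hG := (hasGaussianLaw_pair hlaw hind a b b i i 1).fst
  have hmeas : Measurable fun ω => 1 * (Y a ω i - Y b ω i) := by
    have := hY a
    have := hY b
    fun_prop
  have hvar : Var[fun ω => 1 * (Y a ω i - Y b ω i); μ] = 2 := by
    rw [← covariance_self hmeas.aemeasurable, covariance_diff hY hlaw hind hS hab hab]
    simp [hd]
    norm_num
  have hmap := hG.map_eq_gaussianReal
  rw [hvar] at hmap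
  have hno : NullSingletonClass (μ.map fun ω => 1 * (Y a ω i - Y b ω i)) := by
    rw [hmap]
    exact nullSingletonClass_gaussianReal (by simp)
  have h0 : μ ((fun ω => 1 * (Y a ω i - Y b ω i)) ⁻¹' {0}) = 0 := by
    rw [← Measure.map_apply hmeas (measurableSet_singleton 0)]
    exact measure_singleton 0
  rw [ae_iff]
  refine measure_mono_null (fun ω hω => ?_) h0
  have : Y a ω i = Y b ω i := by simpa [hab] using hω
  simp [this]

/-- The expectation of the kernel of Spearman's correlation. -/
lemma integral_spearmanKernel [IsProbabilityMeasure μ] (hY : ∀ a, Measurable (Y a))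
    (hlaw : ∀ a, μ.map (Y a) = multivariateGaussian 0 Sig) (hind : iIndepFun Y μ)
    (hS : Sig.PosSemidef) (hd : ∀ i, Sig i i = 1) {i j : Fin p} (h1 : |Sig i j| ≤ 1)
    {a b c : Fin n} (hab : a ≠ b) (hac : a ≠ c) (hbc : b ≠ c) :
    ∫ ω, Real.sign (Y a ω i - Y b ω i) * Real.sign (Y a ω j - Y c ω j) ∂μ =
      2 / Real.pi * Real.arcsin (Sig i j / 2) := by
  have hs : 0 < (√2)⁻¹ := by positivity
  have hs2 : (√2)⁻¹ ^ 2 = (2 : ℝ)⁻¹ := by rw [inv_pow, Real.sq_sqrt (by norm_num)]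
  have hL := memLp_two_coord hlaw
  have hint : ∀ a i, Integrable (fun ω => Y a ω i) μ := fun a i =>
    (hL a i).integrable (by norm_num)
  have hmean : ∀ (a b : Fin n) i, ∫ ω, (√2)⁻¹ * (Y a ω i - Y b ω i) ∂μ = 0 := fun a b i => by
    rw [integral_const_mul, integral_sub (hint a i) (hint b i), integral_coord hY hlaw hS,
      integral_coord hY hlaw hS]
    simp
  have hvar : ∀ (b : Fin n) i, a ≠ b → Var[fun ω => (√2)⁻¹ * (Y a ω i - Y b ω i); μ] = 1 :=
    fun b i hab => by
      have hmeas : Measurable fun ω => (√2)⁻¹ * (Y a ω i - Y b ω i) := by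
        have := hY a
        have := hY b
        fun_prop
      rw [← covariance_self hmeas.aemeasurable, covariance_diff hY hlaw hind hS hab hab, hs2, hd,
        if_pos rfl]
      norm_num
  have hcov : cov[fun ω => (√2)⁻¹ * (Y a ω i - Y b ω i),
      fun ω => (√2)⁻¹ * (Y a ω j - Y c ω j); μ] = Sig i j / 2 := by
    rw [covariance_diff hY hlaw hind hS hab hac, hs2, if_neg hbc]
    ring
  rw [abs_le] at h1
  rw [← integral_sign_mul_sign_of_hasGaussianLaw
    (hasGaussianLaw_pair hlaw hind a b c i j (√2)⁻¹) (hmean a b i) (hmean a c j)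
    (hvar b i hab) (hvar c j hac) hcov (by linarith) (by linarith)]
  simp only [realSign_mul_of_pos hs]

end GaussianSample

/-! ### Spearman's correlation without ties -/

section Spearman

variable {n : ℕ}

/-- The sum of the signs of the differences `v k - v l`. -/
noncomputable def signSum (v : Fin n → ℝ) (k : Fin n) : ℝ := ∑ l, Real.sign (v k - v l)

lemma rank_eq_signSum {v : Fin n → ℝ} (hv : Function.Injective v) (k : Fin n) :
    rank v k = (n + 1) / 2 + signSum v k / 2 := by
  have h1 : ∀ l, (if v l ≤ v k then (1 : ℝ) else 0) =
      1 / 2 + Real.sign (v k - v l) / 2 + if l = k then 1 / 2 else 0 := fun l => by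
    rcases lt_trichotomy (v l) (v k) with h | h | h
    · have : l ≠ k := fun e => by simp [e] at h
      rw [if_pos h.le, if_neg this, Real.sign_of_pos (sub_pos.2 h)]
      norm_num
    · have : l = k := hv h
      rw [if_pos h.le, if_pos this, h]
      norm_num
    · have : l ≠ k := fun e => by simp [e] at h
      rw [if_neg (not_le.2 h), if_neg this, Real.sign_of_neg (sub_neg.2 h)]
      norm_num
  rw [rank, Finset.card_filter]
  push_cast
  rw [Finset.sum_congr rfl fun l _ => h1 l, Finset.sum_add_distrib, Finset.sum_add_distrib,
    Finset.sum_ite_eq' Finset.univ k, if_pos (Finset.mem_univ k),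
    ← Finset.sum_div _ (fun l => Real.sign (v k - v l)), signSum]
  simp
  ring

lemma sum_signSum (v : Fin n → ℝ) : ∑ k, signSum v k = 0 := by
  have h : ∑ k, signSum v k = -∑ k, signSum v k := by
    conv_lhs => simp only [signSum]
    rw [Finset.sum_comm, ← Finset.sum_neg_distrib]
    refine Finset.sum_congr rfl fun k _ => ?_
    rw [signSum, ← Finset.sum_neg_distrib]
    refine Finset.sum_congr rfl fun l _ => ?_
    rw [← Real.sign_neg, neg_sub]
  linarith

lemma rank_sub_sampleMean {v : Fin n → ℝ} (hv : Function.Injective v) (k : Fin n) :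
    rank v k - sampleMean (rank v) = signSum v k / 2 := by
  have hn : (n : ℝ) ≠ 0 := by
    have := k.pos
    positivity
  have : sampleMean (rank v) = (n + 1) / 2 := by
    rw [sampleMean, Finset.sum_congr rfl fun k _ => rank_eq_signSum hv k, Finset.sum_add_distrib,
      ← Finset.sum_div _ (signSum v), sum_signSum]
    simp
    field_simp
  rw [this, rank_eq_signSum hv]
  ring

lemma sum_range_sub_sq (N : ℕ) (c : ℝ) :
    ∑ i ∈ Finset.range N, ((i : ℝ) - c) ^ 2 =
      (N : ℝ) * (N - 1) * (2 * N - 1) / 6 - c * N * (N - 1) + c ^ 2 * N := by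
  induction N with
  | zero => simp
  | succ N ih =>
    rw [Finset.sum_range_succ, ih]
    push_cast
    ring

lemma sum_signSum_sq {v : Fin n → ℝ} (hv : Function.Injective v) :
    ∑ k, (signSum v k / 2) ^ 2 = (n : ℝ) * (n ^ 2 - 1) / 12 := by
  have hpos : ∀ k, 0 < (Finset.univ.filter fun l => v l ≤ v k).card := fun k =>
    Finset.card_pos.2 ⟨k, by simp⟩
  have hlt : ∀ k, (Finset.univ.filter fun l => v l ≤ v k).card - 1 < n := fun k => by
    have h1 := hpos k
    have h2 := Finset.card_le_univ (Finset.univ.filter fun l => v l ≤ v k)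
    rw [Fintype.card_fin] at h2
    omega
  set r : Fin n → Fin n := fun k => ⟨(Finset.univ.filter fun l => v l ≤ v k).card - 1, hlt k⟩
    with hr
  have hinj : Function.Injective r := by
    have hmono : ∀ k k', v k < v k' → r k < r k' := fun k k' hk => by
      have hss : (Finset.univ.filter fun l => v l ≤ v k) ⊂
          Finset.univ.filter fun l => v l ≤ v k' := by
        refine Finset.ssubset_iff_subset_ne.2 ⟨fun l hl => ?_, fun e => ?_⟩
        · simp only [Finset.mem_filter, Finset.mem_univ, true_and] at hl ⊢
          exact hl.trans hk.le
        · have : k' ∈ Finset.univ.filter fun l => v l ≤ v k := by rw [e]; simp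
          simp only [Finset.mem_filter, Finset.mem_univ, true_and] at this
          exact absurd hk (not_lt.2 this)
      have h1 := Finset.card_lt_card hss
      have h2 := hpos k
      simp only [hr, Fin.mk_lt_mk]
      omega
    intro k k' h
    by_contra hne
    rcases lt_or_gt_of_ne (fun e => hne (hv e)) with hk | hk
    · exact absurd h (hmono _ _ hk).ne
    · exact absurd h (hmono _ _ hk).ne'
  have hval : ∀ k, (signSum v k / 2) ^ 2 = (((r k : ℕ) : ℝ) - (n - 1) / 2) ^ 2 := fun k => by
    have h1 := rank_eq_signSum hv k
    have h2 : ((r k : ℕ) : ℝ) = rank v k - 1 := by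
      simp only [hr, rank]
      rw [Nat.cast_sub (hpos k), Nat.cast_one]
    rw [h2, h1]
    ring
  rw [Finset.sum_congr rfl fun k _ => hval k,
    (Finite.injective_iff_bijective.1 hinj).sum_comp fun i : Fin n =>
      (((i : ℕ) : ℝ) - (n - 1) / 2) ^ 2,
    Fin.sum_univ_eq_sum_range fun i : ℕ => ((i : ℝ) - ((n : ℝ) - 1) / 2) ^ 2, sum_range_sub_sq]
  ring

lemma spearman_eq_signSum {x y : Fin n → ℝ} (hx : Function.Injective x)
    (hy : Function.Injective y) :
    (n : ℝ) * (n ^ 2 - 1) / 3 * spearman x y = ∑ k, signSum x k * signSum y k := by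
  rcases Nat.lt_or_ge n 2 with hn | hn
  · have h0 : (n : ℝ) * (n ^ 2 - 1) = 0 := by interval_cases n <;> simp
    have h1 : ∀ k, signSum x k = 0 := fun k => by
      have : Subsingleton (Fin n) := Fin.subsingleton_iff_le_one.2 (by omega)
      rw [signSum]
      exact Finset.sum_eq_zero fun l _ => by rw [Subsingleton.elim l k, sub_self, Real.sign_zero]
    simp [h0, h1]
  have hn' : (2 : ℝ) ≤ n := by exact_mod_cast hn
  have hs : 0 < (n : ℝ) * (n ^ 2 - 1) / 12 := by
    have : 0 < (n : ℝ) ^ 2 - 1 := by nlinarith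
    positivity
  rw [spearman, pearson]
  simp only [rank_sub_sampleMean hx, rank_sub_sampleMean hy]
  rw [sum_signSum_sq hx, sum_signSum_sq hy, Real.mul_self_sqrt hs.le]
  have e : ∑ k, signSum x k / 2 * (signSum y k / 2) = (∑ k, signSum x k * signSum y k) / 4 := by
    rw [Finset.sum_div]
    exact Finset.sum_congr rfl fun k _ => by ring
  have h1 : (n : ℝ) ^ 2 - 1 ≠ 0 := by nlinarith
  have h2 : (n : ℝ) ≠ 0 := by positivity
  rw [e]
  field_simp
  ring

/-- The kernel of Spearman's correlation at a triple of observations. -/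
noncomputable def spearmanKernel (x y : Fin n → ℝ) (t : Fin 3 ↪ Fin n) : ℝ :=
  Real.sign (x (t 0) - x (t 1)) * Real.sign (y (t 0) - y (t 2))

/-- Spearman's correlation is a U-statistic up to a term of lower order. -/
lemma abs_spearman_sub_sum_kernel_le {x y : Fin n → ℝ} (hx : Function.Injective x)
    (hy : Function.Injective y) :
    |(n : ℝ) * (n ^ 2 - 1) / 3 * spearman x y - ∑ t, spearmanKernel x y t| ≤ (n : ℝ) ^ 2 := by
  set f : Fin n × Fin n × Fin n → ℝ := fun q =>
    Real.sign (x q.1 - x q.2.1) * Real.sign (y q.1 - y q.2.2) with hf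
  set A : Finset (Fin n × Fin n × Fin n) :=
    Finset.univ.filter fun q => q.1 ≠ q.2.1 ∧ q.1 ≠ q.2.2 ∧ q.2.1 ≠ q.2.2 with hA
  have htotal : (n : ℝ) * (n ^ 2 - 1) / 3 * spearman x y = ∑ q, f q := by
    rw [spearman_eq_signSum hx hy, Fintype.sum_prod_type]
    refine Finset.sum_congr rfl fun k _ => ?_
    rw [signSum, signSum, Finset.sum_mul_sum, Fintype.sum_prod_type]
  have hemb : ∑ t, spearmanKernel x y t = ∑ q ∈ A, f q := by
    refine Finset.sum_bij (fun t _ => (t 0, t 1, t 2)) (fun t _ => ?_) (fun t _ t' _ h => ?_)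
      (fun q hq => ?_) fun t _ => rfl
    · simp [hA]
    · simp only [Prod.mk.injEq] at h
      ext i
      fin_cases i
      · exact congrArg _ h.1
      · exact congrArg _ h.2.1
      · exact congrArg _ h.2.2
    · obtain ⟨-, h1, h2, h3⟩ := Finset.mem_filter.1 hq
      refine ⟨⟨![q.1, q.2.1, q.2.2], ?_⟩, Finset.mem_univ _, rfl⟩
      intro i j hij
      fin_cases i <;> fin_cases j <;> simp_all
  rw [htotal, hemb, ← Finset.sum_add_sum_compl A f, add_sub_cancel_left]
  refine (Finset.abs_sum_le_sum_abs _ _).trans ?_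
  have hle : ∀ q ∈ Aᶜ, |f q| ≤ if q.2.1 = q.2.2 then (1 : ℝ) else 0 := fun q hq => by
    split_ifs with h
    · simp only [hf, abs_mul]
      exact mul_le_one₀ (abs_realSign_le_one _) (abs_nonneg _) (abs_realSign_le_one _)
    · have : q.1 = q.2.1 ∨ q.1 = q.2.2 := by
        by_contra hne
        push Not at hne
        exact Finset.mem_compl.1 hq (Finset.mem_filter.2 ⟨Finset.mem_univ _, hne.1, hne.2, h⟩)
      rcases this with h | h <;> simp [hf, h]
  refine (Finset.sum_le_sum hle).trans ((Finset.sum_le_sum_of_subset_of_nonneg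
    (Finset.subset_univ _) fun q _ _ => by split_ifs <;> norm_num).trans (le_of_eq ?_))
  rw [Fintype.sum_prod_type]
  simp only [Fintype.sum_prod_type, Finset.sum_ite_eq, Finset.mem_univ, if_true, Finset.sum_const,
    Finset.card_univ, Fintype.card_fin, nsmul_eq_mul, mul_one]
  ring

lemma card_triples (hn : 3 ≤ n) :
    (Fintype.card (Fin 3 ↪ Fin n) : ℝ) = n * (n - 1) * (n - 2) := by
  obtain ⟨m, rfl⟩ := Nat.exists_eq_add_of_le hn
  rw [Fintype.card_embedding_eq, Fintype.card_fin, Fintype.card_fin]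
  have : (3 + m).descFactorial 3 = (3 + m) * (2 + m) * (1 + m) := by
    simp only [Nat.descFactorial_succ, Nat.descFactorial_zero]
    have e1 : 3 + m - 2 = 1 + m := by omega
    have e2 : 3 + m - 1 = 2 + m := by omega
    rw [e1, e2]
    simp
    ring
  rw [this]
  push_cast
  ring

/-- A deviation of the adjusted correlation is a deviation of the U-statistic. -/
lemma abs_adjusted_sub_le {x y : Fin n → ℝ} (hn : 3 ≤ n) (hx : Function.Injective x)
    (hy : Function.Injective y) {ρ ε : ℝ} (hρ : |ρ| ≤ 1)
    (hε : |∑ t, (spearmanKernel x y t - 2 / Real.pi * Real.arcsin (ρ / 2))| ≤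
      Fintype.card (Fin 3 ↪ Fin n) * ε) :
    |2 * Real.sin (Real.pi / 6 * spearman x y) - ρ| ≤ 32 / n + 4 * ε := by
  set θ := 2 / Real.pi * Real.arcsin (ρ / 2) with hθ
  have hpi := Real.pi_pos
  rw [abs_le] at hρ
  have hθ1 : |θ| ≤ 1 := by
    rw [hθ, abs_mul, abs_of_pos (by positivity : 0 < 2 / Real.pi)]
    have : |Real.arcsin (ρ / 2)| ≤ Real.pi / 2 :=
      abs_le.2 ⟨Real.neg_pi_div_two_le_arcsin _, Real.arcsin_le_pi_div_two _⟩
    calc 2 / Real.pi * |Real.arcsin (ρ / 2)| ≤ 2 / Real.pi * (Real.pi / 2) := by gcongr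
      _ = 1 := by field_simp
  have hn' : (3 : ℝ) ≤ n := by exact_mod_cast hn
  have hcard := card_triples hn
  have hsin : 2 * Real.sin (Real.pi / 6 * (3 * θ)) = ρ := by
    have : Real.pi / 6 * (3 * θ) = Real.arcsin (ρ / 2) := by
      rw [hθ]
      field_simp
      ring
    rw [this, Real.sin_arcsin (by linarith) (by linarith)]
    ring
  have hr : |spearman x y - 3 * θ| ≤ 24 / n + 3 * ε := by
    have hU := abs_spearman_sub_sum_kernel_le hx hy
    rw [Finset.sum_sub_distrib, Finset.sum_const, Finset.card_univ, nsmul_eq_mul] at hε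
    set c : ℝ := (Fintype.card (Fin 3 ↪ Fin n) : ℝ) with hc
    have hc0 : 0 < c := by
      rw [hcard]
      exact mul_pos (mul_pos (by linarith) (by linarith)) (by linarith)
    have hε0 : 0 ≤ ε := by
      have := (abs_nonneg _).trans hε
      exact nonneg_of_mul_nonneg_right this hc0
    set a : ℝ := (n : ℝ) * (n ^ 2 - 1) / 3 with ha
    have ha0 : 0 < a := by
      have : 0 < (n : ℝ) ^ 2 - 1 := by nlinarith
      positivity
    have hca : c = 3 * a - 3 * (n * (n - 1)) := by rw [hcard, ha]; ring
    have hnn : 0 ≤ (n : ℝ) * (n - 1) := mul_nonneg (by linarith) (by linarith)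
    have hθn : |3 * (n * (n - 1)) * θ| ≤ 3 * (n : ℝ) ^ 2 := by
      rw [abs_mul, abs_of_nonneg (by positivity)]
      nlinarith [abs_nonneg θ]
    have e : a * (spearman x y - 3 * θ) = (a * spearman x y - ∑ t, spearmanKernel x y t) +
        (∑ t, spearmanKernel x y t - c * θ) - 3 * (n * (n - 1)) * θ := by
      rw [hca]
      ring
    have h1 : a * |spearman x y - 3 * θ| ≤ 4 * (n : ℝ) ^ 2 + c * ε := by
      have habs : a * |spearman x y - 3 * θ| = |a * (spearman x y - 3 * θ)| := by
        rw [abs_mul, abs_of_pos ha0]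
      rw [habs, e]
      refine (abs_sub _ _).trans ?_
      have := abs_add_le (a * spearman x y - ∑ t, spearmanKernel x y t)
        (∑ t, spearmanKernel x y t - c * θ)
      linarith
    have h2 : 4 * (n : ℝ) ^ 2 + c * ε ≤ a * (24 / n + 3 * ε) := by
      have h3 : c * ε ≤ a * (3 * ε) := by
        rw [hca]
        nlinarith
      have h4 : 4 * (n : ℝ) ^ 2 ≤ a * (24 / n) := by
        have : a * (24 / n) = 8 * (n ^ 2 - 1) := by
          rw [ha]
          field_simp
          ring
        rw [this]
        nlinarith
      rw [mul_add]
      linarith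
    exact le_of_mul_le_mul_left (h1.trans h2) ha0
  have h3 := Real.abs_sin_sub_sin_le (Real.pi / 6 * spearman x y) (Real.pi / 6 * (3 * θ))
  rw [← mul_sub, abs_mul, abs_of_pos (by positivity : 0 < Real.pi / 6)] at h3
  have h4 : Real.pi / 6 * |spearman x y - 3 * θ| ≤ 2 / 3 * (24 / n + 3 * ε) :=
    mul_le_mul (by linarith [Real.pi_le_four]) hr (abs_nonneg _) (by norm_num)
  rw [← hsin, ← mul_sub, abs_mul, abs_two]
  have e : 2 * (2 / 3 * (24 / (n : ℝ) + 3 * ε)) = 32 / n + 4 * ε := by ring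
  linarith

end Spearman

/-! ### Concentration of the adjusted Spearman correlation matrix -/

section Concentration

lemma rank_congr {n : ℕ} {v w : Fin n → ℝ} (h : ∀ k l, v l ≤ v k ↔ w l ≤ w k) :
    rank v = rank w := by
  ext k
  simp only [rank, h]

lemma inv_natCast_le_two_mul_sqrt {n p : ℕ} (hn : 1 ≤ n) (hp : 2 ≤ p) :
    1 / (n : ℝ) ≤ 2 * √(Real.log p / n) := by
  have hn' : (1 : ℝ) ≤ n := by exact_mod_cast hn
  have hlog : 1 / 4 ≤ Real.log p := by
    have := Real.log_le_log (by norm_num) (by exact_mod_cast hp : (2 : ℝ) ≤ p)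
    linarith [Real.log_two_gt_d9]
  refine abs_le_of_sq_le_sq' ?_ (by positivity) |>.2
  rw [mul_pow, Real.sq_sqrt (by positivity), one_div, inv_pow, inv_eq_one_div,
    mul_div_assoc', div_le_div_iff₀ (by positivity) (by positivity)]
  nlinarith

variable {Ω : Type*} {mΩ : MeasurableSpace Ω} {μ : Measure Ω} {n p : ℕ}
  {Sig : Matrix (Fin p) (Fin p) ℝ}

/-- Concentration of the U-statistic behind one entry of the matrix. -/
lemma measureReal_sum_kernel_le [IsProbabilityMeasure μ]
    {Y : Fin n → Ω → EuclideanSpace ℝ (Fin p)} (hY : ∀ a, Measurable (Y a))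
    (hlaw : ∀ a, μ.map (Y a) = multivariateGaussian 0 Sig) (hind : iIndepFun Y μ)
    (hS : Sig.PosDef) (hd : ∀ i, Sig i i = 1) (hn : 3 ≤ n) (i j : Fin p) {ε : ℝ} (hε : 0 ≤ ε) :
    μ.real {ω | Fintype.card (Fin 3 ↪ Fin n) * ε ≤
      |∑ t, (spearmanKernel (fun a => Y a ω i) (fun a => Y a ω j) t -
        2 / Real.pi * Real.arcsin (Sig i j / 2))|} ≤ 2 * Real.exp (-(n * ε ^ 2 / 12)) := by
  set θ := 2 / Real.pi * Real.arcsin (Sig i j / 2) with hθdef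
  set F : (Fin 3 → EuclideanSpace ℝ (Fin p)) → ℝ := fun z =>
    Real.sign (z 0 i - z 1 i) * Real.sign (z 0 j - z 2 j) with hF
  have hFm : Measurable F := by
    have := measurable_realSign
    fun_prop
  have hF1 : ∀ z, |F z| ≤ 1 := fun z => by
    simp only [hF, abs_mul]
    exact mul_le_one₀ (abs_realSign_le_one _) (abs_nonneg _) (abs_realSign_le_one _)
  have hθ : ∀ t : Fin 3 ↪ Fin n, ∫ ω, F (fun i => Y (t i) ω) ∂μ = θ := fun t =>
    integral_spearmanKernel hY hlaw hind hS.posSemidef hd (abs_apply_le_one hS hd i j)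
      (t.injective.ne (by decide)) (t.injective.ne (by decide)) (t.injective.ne (by decide))
  have hm0 : 0 < n / 3 := Nat.div_pos hn (by norm_num)
  have hm : 3 * (n / 3) ≤ n := Nat.mul_div_le n 3
  have h1 := measure_uStatistic_ge_le (μ := μ) hY hind hFm (fun z => abs_le.1 (hF1 z)) hθ hm hm0 hε
  have h2 := measure_uStatistic_ge_le (μ := μ) hY hind hFm.neg
    (fun z => abs_le.1 (by simpa using hF1 z)) (θ := -θ)
    (fun t => by simp only [Pi.neg_apply]; rw [integral_neg, hθ]) hm hm0 hε
  have hexp : Real.exp (-(((n / 3 : ℕ) : ℝ) * ε ^ 2 / 2)) ≤ Real.exp (-(n * ε ^ 2 / 12)) := by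
    refine Real.exp_le_exp.2 ?_
    have : (n : ℝ) ≤ 6 * ((n / 3 : ℕ) : ℝ) := by
      have : n ≤ 6 * (n / 3) := by omega
      exact_mod_cast this
    nlinarith [mul_le_mul_of_nonneg_right this (sq_nonneg ε)]
  refine (measureReal_mono (μ := μ) (fun ω hω => ?_)).trans
    ((measureReal_union_le _ _).trans ((add_le_add (h1.trans hexp) (h2.trans hexp)).trans
      (le_of_eq (by ring))))
  rw [Set.mem_ofPred_eq] at hω
  rcases le_abs.1 hω with h | h
  · exact Or.inl h
  · refine Or.inr ?_
    simp only [Set.mem_ofPred_eq, Pi.neg_apply]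
    refine h.trans (le_of_eq ?_)
    rw [← Finset.sum_neg_distrib]
    refine Finset.sum_congr rfl fun t _ => ?_
    simp only [hF, spearmanKernel]
    ring

/-- The adjusted Spearman correlation matrix is uniformly close to the population matrix. -/
theorem measure_rankCorr_deviation_le [IsProbabilityMeasure μ] {P : Measure (Fin p → ℝ)}
    {X : Fin n → Ω → Fin p → ℝ} (hP : IsNonparanormal P Sig) (hX : ∀ k, Measurable (X k))
    (hlaw : ∀ k, μ.map (X k) = P) (hind : iIndepFun X μ) (hn : 3 ≤ n) (hp : 2 ≤ p)
    {K : ℝ} (hK : 128 ≤ K) :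
    μ {ω | ¬ ∀ i j, |rankCorr (fun k => X k ω) i j - Sig i j| ≤ K * √(Real.log p / n)} ≤
      ENNReal.ofReal (2 * Real.exp (-(K ^ 2 / 1536 * Real.log p))) := by
  obtain ⟨hS, hd, f, hf, hmap⟩ := hP
  set φ : (Fin p → ℝ) → EuclideanSpace ℝ (Fin p) := fun x => WithLp.toLp 2 fun j => f j (x j)
    with hφ
  have hφm : Measurable φ := by
    have : ∀ j, Measurable (f j) := fun j => (hf j).measurable
    have h2 : Measurable fun x : Fin p → ℝ => fun j => f j (x j) := by fun_prop
    exact (WithLp.measurable_toLp 2 _).comp h2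
  set Y : Fin n → Ω → EuclideanSpace ℝ (Fin p) := fun k ω => φ (X k ω) with hYdef
  have hY : ∀ k, Measurable (Y k) := fun k => hφm.comp (hX k)
  have hYlaw : ∀ k, μ.map (Y k) = multivariateGaussian 0 Sig := fun k => by
    rw [← hmap, ← hlaw k, Measure.map_map hφm (hX k)]
    rfl
  have hYind : iIndepFun Y μ := hind.comp (fun _ => φ) fun _ => hφm
  have hties := ae_ne_of_gaussian hY hYlaw hYind hS.posSemidef hd
  set s := √(Real.log p / n) with hs
  have hn' : (3 : ℝ) ≤ n := by exact_mod_cast hn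
  have hn0 : (0 : ℝ) < n := by linarith
  have hp' : (2 : ℝ) ≤ p := by exact_mod_cast hp
  have hlog : 0 ≤ Real.log p := Real.log_natCast_nonneg p
  have hs2 : n * s ^ 2 = Real.log p := by
    rw [hs, Real.sq_sqrt (by positivity)]
    field_simp
  have hsn : 1 / (n : ℝ) ≤ 2 * s := inv_natCast_le_two_mul_sqrt (by omega) hp
  set ε : ℝ := K * s / 8 with hε
  have hε0 : 0 ≤ ε := by positivity
  set A : Fin p × Fin p → Set Ω := fun q => {ω | Fintype.card (Fin 3 ↪ Fin n) * ε ≤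
      |∑ t, (spearmanKernel (fun a => Y a ω q.1) (fun a => Y a ω q.2) t -
        2 / Real.pi * Real.arcsin (Sig q.1 q.2 / 2))|} with hA
  have hsub : {ω | ¬ ∀ i j, |rankCorr (fun k => X k ω) i j - Sig i j| ≤ K * s} ⊆
      {ω | ¬ ∀ (i : Fin p) (a b : Fin n), a ≠ b → Y a ω i ≠ Y b ω i} ∪ ⋃ q, A q := by
    intro ω hω
    by_contra hnot
    rw [Set.mem_union, not_or, Set.mem_iUnion, not_exists] at hnot
    obtain ⟨h1, h2⟩ := hnot
    replace h1 : ∀ (i : Fin p) (a b : Fin n), a ≠ b → Y a ω i ≠ Y b ω i := not_not.1 h1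
    refine hω fun i j => ?_
    have hinj : ∀ i, Function.Injective fun a => Y a ω i := fun i a b hab => by
      by_contra hne
      exact h1 i a b hne hab
    have hrank : ∀ i, rank (fun k => X k ω i) = rank fun k => Y k ω i := fun i => by
      refine rank_congr fun k l => ⟨fun h => hf i h, fun h => ?_⟩
      by_contra hlt
      have h3 : Y k ω i ≤ Y l ω i := hf i (not_le.1 hlt).le
      have h4 := hinj i (le_antisymm h h3)
      rw [h4] at hlt
      exact hlt le_rfl
    have hsp : spearman (fun k => X k ω i) (fun k => X k ω j) =
        spearman (fun k => Y k ω i) fun k => Y k ω j := by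
      rw [spearman, spearman, hrank, hrank]
    have h5 := abs_adjusted_sub_le hn (hinj i) (hinj j) (abs_apply_le_one hS hd i j)
      (not_le.1 (h2 (i, j))).le
    rw [rankCorr, Matrix.of_apply, hsp]
    refine h5.trans ?_
    have h6 : 32 / (n : ℝ) = 32 * (1 / n) := by ring
    have h7 : 64 * s ≤ K * s / 2 := by nlinarith [Real.sqrt_nonneg (Real.log p / n)]
    rw [h6, hε]
    linarith
  have hAq : ∀ q, μ (A q) ≤ ENNReal.ofReal (2 * Real.exp (-(K ^ 2 * Real.log p / 768))) :=
    fun q => by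
      have h1 := measureReal_sum_kernel_le hY hYlaw hYind hS hd hn q.1 q.2 hε0
      have h2 : n * ε ^ 2 / 12 = K ^ 2 * Real.log p / 768 := by
        rw [← hs2, hε]
        ring
      rw [h2] at h1
      rw [← ofReal_measureReal]
      exact ENNReal.ofReal_le_ofReal h1
  have hnull : μ {ω | ¬ ∀ (i : Fin p) (a b : Fin n), a ≠ b → Y a ω i ≠ Y b ω i} = 0 := hties
  refine (measure_mono hsub).trans ((measure_union_le _ _).trans ?_)
  rw [hnull, zero_add]
  refine (measure_iUnion_fintype_le _ _).trans ((Finset.sum_le_sum fun q _ => hAq q).trans ?_)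
  rw [Finset.sum_const, Finset.card_univ, Fintype.card_prod, Fintype.card_fin, nsmul_eq_mul,
    ← ENNReal.ofReal_natCast, ← ENNReal.ofReal_mul (by positivity)]
  refine ENNReal.ofReal_le_ofReal ?_
  have hpp : ((p * p : ℕ) : ℝ) = Real.exp (2 * Real.log p) := by
    rw [two_mul, Real.exp_add, Real.exp_log (by linarith)]
    push_cast
    rfl
  rw [hpp, mul_left_comm, ← Real.exp_add]
  refine mul_le_mul_of_nonneg_left (Real.exp_le_exp.2 ?_) (by norm_num)
  have : 2 ≤ K ^ 2 / 1536 := by nlinarith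
  nlinarith

end Concentration

/-! ### Asymptotics -/

section Asymptotics

lemma one_le_maxDegree {p : ℕ} {T : Matrix (Fin p) (Fin p) ℝ} (h : (offSupport T).Nonempty) :
    1 ≤ maxDegree T := by
  obtain ⟨⟨i, j⟩, hij, hT⟩ := h
  refine le_trans (Finset.card_pos.2 ⟨j, ?_⟩)
    (Finset.le_sup (f := fun k => (activeSet T k).card) (Finset.mem_univ i))
  exact Finset.mem_filter.2 ⟨Finset.mem_univ _, Ne.symm hij, hT⟩

lemma two_le_of_offSupport_nonempty {p : ℕ} {T : Matrix (Fin p) (Fin p) ℝ}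
    (h : (offSupport T).Nonempty) : 2 ≤ p := by
  obtain ⟨⟨i, j⟩, hij, -⟩ := h
  by_contra hp
  have : Subsingleton (Fin p) := Fin.subsingleton_iff_le_one.2 (by omega)
  exact hij (Subsingleton.elim i j)

lemma tendsto_mul_sqrt_of_isLittleO {d : ℕ → ℕ} {p : ℕ → ℕ}
    (h : (fun n => (d n : ℝ) ^ 2 * Real.log (p n)) =o[atTop] (fun n => (n : ℝ))) :
    Tendsto (fun n => (d n : ℝ) * √(Real.log (p n) / n)) atTop (𝓝 0) := by
  have h1 := (h.tendsto_div_nhds_zero).sqrt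
  rw [Real.sqrt_zero] at h1
  refine h1.congr fun n => ?_
  rw [mul_div_assoc, Real.sqrt_mul (sq_nonneg _), Real.sqrt_sq (Nat.cast_nonneg _)]

/-- Once the matrix estimate is of the right order, the procedure succeeds for all large `n`. -/
theorem eventually_adaptiveClimeSucceeds {psi0 M0 G0 H0 : ℝ} (hpsi0 : 0 < psi0) {p : ℕ → ℕ}
    {Sig : ∀ n, Matrix (Fin (p n)) (Fin (p n)) ℝ} {lamc lamac : ℕ → ℝ}
    (hS : ∀ n, (Sig n).PosDef) (hd : ∀ n i, Sig n i i = 1)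
    (hedge : ∀ n, (offSupport (Sig n)⁻¹).Nonempty)
    (hpsi : ∀ n, psi0 ≤ psiMin (Sig n)⁻¹) (hM : ∀ n, matrixL1 (Sig n)⁻¹ ≤ M0)
    (hG : ∀ n k, tildeG (Sig n) k ≤ G0) (hH : ∀ n k, tildeH (Sig n) k ≤ H0)
    (hgrow : (fun n => (maxDegree (Sig n)⁻¹ : ℝ) ^ 2 * Real.log (p n)) =o[atTop]
      (fun n => (n : ℝ)))
    (hO : lamc =O[atTop] (fun n => √(Real.log (p n) / n)))
    (hlow : ∀ᶠ n in atTop, √(Real.log (p n) / n) ≤ lamc n)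
    (hpos : ∀ n, 0 < lamac n)
    (hlamac : lamac =o[atTop] (fun n => min (activeEigMin (Sig n) / (maxDegree (Sig n)⁻¹ : ℝ))
      (1 / (maxDegree (Sig n)⁻¹ : ℝ))))
    (hlam : lamc =o[atTop] lamac) {K : ℝ} (hK : 0 ≤ K) :
    ∀ᶠ n in atTop, ∀ R T₀ : Matrix (Fin (p n)) (Fin (p n)) ℝ,
      (∀ i j, |R i j - Sig n i j| ≤ K * √(Real.log (p n) / n)) →
      (∀ i j, |(R * T₀ - 1) i j| ≤ lamc n) → (∀ k, ∑ i, |T₀ i k| ≤ 2 * max M0 1) →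
      AdaptiveClimeSucceeds n R (Sig n)⁻¹ (lamc n) (lamac n) := by
  set s : ℕ → ℝ := fun n => √(Real.log (p n) / n) with hs
  set d : ℕ → ℝ := fun n => (maxDegree (Sig n)⁻¹ : ℝ) with hddef
  set M := max M0 1 with hMdef
  set G := max G0 1 with hGdef
  set H := max H0 1 with hHdef
  set ψ := min psi0 1 with hψdef
  have hM1 : 1 ≤ M := le_max_right _ _
  have hG1 : 1 ≤ G := le_max_right _ _
  have hH1 : 1 ≤ H := le_max_right _ _
  have hψ0 : 0 < ψ := lt_min hpsi0 one_pos
  have hs0 : ∀ n, 0 ≤ s n := fun n => Real.sqrt_nonneg _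
  have hd1 : ∀ n, 1 ≤ d n := fun n => by
    simp only [hddef]
    exact_mod_cast one_le_maxDegree (hedge n)
  have hds : Tendsto (fun n => d n * s n) atTop (𝓝 0) := tendsto_mul_sqrt_of_isLittleO hgrow
  have hst : Tendsto s atTop (𝓝 0) :=
    squeeze_zero hs0 (fun n => le_mul_of_one_le_left (hs0 n) (hd1 n)) hds
  have hdl : Tendsto (fun n => d n * lamac n) atTop (𝓝 0) := by
    have h1 : (fun n => d n * lamac n) =o[atTop] fun n => d n * min
        (activeEigMin (Sig n) / d n) (1 / d n) := (isBigO_refl d atTop).mul_isLittleO hlamac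
    refine (isLittleO_one_iff ℝ).1 (h1.trans_isBigO (IsBigO.of_bound 1 (Eventually.of_forall
      fun n => ?_)))
    have hdn : 0 < d n := one_pos.trans_le (hd1 n)
    have h2 : 0 ≤ min (activeEigMin (Sig n) / d n) (1 / d n) :=
      le_min (div_nonneg (activeEigMin_nonneg (hS n)) hdn.le) (by positivity)
    rw [Real.norm_of_nonneg (mul_nonneg hdn.le h2), norm_one, mul_one]
    calc _ ≤ d n * (1 / d n) := mul_le_mul_of_nonneg_left (min_le_right _ _) hdn.le
      _ = 1 := by field_simp
  obtain ⟨L, hL0, hL⟩ := hO.exists_pos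
  set B := M * (L + K * (2 * M)) with hB
  have hB0 : 0 < B := by positivity
  set c₁ := 2 * G * (2 / ψ) * (M + 2) with hc₁
  have hc₁0 : 0 < c₁ := by positivity
  set c₂ := 2 * (c₁ + 2 * G) * (B + 2) with hc₂
  have hc₂0 : 0 < c₂ := by positivity
  have small : ∀ {u : ℕ → ℝ} (c : ℝ) {η : ℝ}, Tendsto u atTop (𝓝 0) → 0 < η →
      ∀ᶠ n in atTop, c * u n < η := fun c η hu hη => by
    have := hu.const_mul c
    rw [mul_zero] at this
    exact this.eventually_lt_const hη
  filter_upwards [eventually_ge_atTop 1, hL.bound, hlow, hlam.bound (inv_pos.2 hc₂0),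
    small K hst one_pos, small (G * (2 * K)) hds (by norm_num : (0 : ℝ) < 1 / 2),
    small B hst (half_pos hψ0), small (2 / ψ * (2 * H + 1) * (B + 2)) hst one_pos,
    small (G * 2 * (2 / ψ)) hdl (half_pos hψ0), small (G * 2 * (K * c₁)) hds (half_pos hψ0)]
    with n hn hLn hlown hlamn h1 h2 h3 h4 h5 h6 R T₀ hR hT₀ hT₀M
  have hsn : 1 / (n : ℝ) ≤ 2 * s n :=
    inv_natCast_le_two_mul_sqrt hn (two_le_of_offSupport_nonempty (hedge n))
  have hlam0 : 0 ≤ lamc n := (hs0 n).trans hlown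
  rw [Real.norm_of_nonneg hlam0, Real.norm_of_nonneg (hs0 n)] at hLn
  rw [Real.norm_of_nonneg hlam0, Real.norm_of_nonneg (hpos n).le] at hlamn
  have hD : d n + 1 ≤ 2 * d n := by linarith [hd1 n]
  have hMB : M * (lamc n + K * s n * (2 * M)) ≤ B * s n := by
    have := mul_le_mul_of_nonneg_left (add_le_add_left hLn (K * s n * (2 * M)))
      (by linarith : 0 ≤ M)
    rw [hB]
    linarith
  have hKs : 0 ≤ K * s n := mul_nonneg hK (hs0 n)
  refine adaptiveClimeSucceeds_of_close (G := G) (H := H) (M := M) (ψ := ψ) (δ := K * s n)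
    (ν := (B + 2) * s n) hn (hS n) (hd n) (fun k => (hG n k).trans (le_max_left _ _)) hG1
    (fun k => (hH n k).trans (le_max_left _ _)) hH1 ((hM n).trans (le_max_left _ _)) hM1
    ((min_le_left _ _).trans (hpsi n)) hψ0 (min_le_right _ _) hR h1.le ?_ hT₀ hT₀M (hpos n).le
    (hMB.trans h3.le) ?_ ?_ ?_ ?_
  · calc G * ((d n + 1) * (K * s n)) ≤ G * (2 * d n * (K * s n)) := by gcongr
      _ = G * (2 * K) * (d n * s n) := by ring
      _ ≤ 1 / 2 := h2.le
  · linarith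
  · linarith
  · calc 2 * (c₁ + 2 * G) * ((B + 2) * s n) = c₂ * s n := by rw [hc₂]; ring
      _ ≤ c₂ * (c₂⁻¹ * lamac n) := by
        refine mul_le_mul_of_nonneg_left (hlown.trans hlamn) hc₂0.le
      _ = lamac n := by rw [mul_inv_cancel_left₀ hc₂0.ne']
  · have := (hpos n).le
    calc G * ((d n + 1) * (lamac n * (2 / ψ) + K * s n * c₁))
        ≤ G * (2 * d n * (lamac n * (2 / ψ) + K * s n * c₁)) := by gcongr
      _ = G * 2 * (2 / ψ) * (d n * lamac n) + G * 2 * (K * c₁) * (d n * s n) := by ring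
      _ < ψ := by linarith

lemma tendsto_measure_one_of_compl_le {Ω : ℕ → Type*} [∀ n, MeasurableSpace (Ω n)]
    {μ : ∀ n, Measure (Ω n)} [∀ n, IsProbabilityMeasure (μ n)] {A : ∀ n, Set (Ω n)}
    (h : ∀ ε : ℝ, 0 < ε → ∀ᶠ n in atTop, μ n (A n)ᶜ ≤ ENNReal.ofReal ε) :
    Tendsto (fun n => μ n (A n)) atTop (𝓝 1) := by
  refine (ENNReal.tendsto_nhds ENNReal.one_ne_top).2 fun ε hε => ?_
  rcases eq_or_ne ε ⊤ with rfl | hε'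
  · exact Eventually.of_forall fun n => by simp
  filter_upwards [h ε.toReal (ENNReal.toReal_pos hε.ne' hε')] with n hn
  rw [ENNReal.ofReal_toReal hε'] at hn
  refine ⟨?_, prob_le_one.trans le_self_add⟩
  rw [tsub_le_iff_right]
  calc (1 : ENNReal) = μ n (A n ∪ (A n)ᶜ) := by rw [Set.union_compl_self, measure_univ]
    _ ≤ μ n (A n) + μ n (A n)ᶜ := measure_union_le _ _
    _ ≤ _ := by gcongr

end Asymptotics

end RankClime

theorem corollary4 :
    ∃ C : ℝ, 0 < C ∧
      ∀ (psi0 M0 G0 H0 : ℝ), 0 < psi0 →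
      ∀ (p : ℕ → ℕ) (Sig : ∀ n, Matrix (Fin (p n)) (Fin (p n)) ℝ)
        (P : ∀ n, Measure (Fin (p n) → ℝ))
        (Ω : ℕ → Type*) [∀ n, MeasurableSpace (Ω n)]
        (μ : ∀ n, Measure (Ω n)) [∀ n, IsProbabilityMeasure (μ n)]
        (X : ∀ n, Fin n → Ω n → Fin (p n) → ℝ)
        (lamc lamac : ℕ → ℝ),
      -- the rows of the data matrix are `n` i.i.d. observations from a nonparanormal law
      (∀ n, RankClime.IsNonparanormal (P n) (Sig n)) →
      (∀ n k, Measurable (X n k)) →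
      (∀ n k, (μ n).map (X n k) = P n) →
      (∀ n, iIndepFun (X n) (μ n)) →
      -- the true graph has at least one edge
      (∀ n, (RankClime.offSupport (Sig n)⁻¹).Nonempty) →
      -- constants
      (∀ n, psi0 ≤ RankClime.psiMin (Sig n)⁻¹) →
      (∀ n, RankClime.matrixL1 (Sig n)⁻¹ ≤ M0) →
      (∀ n k, RankClime.tildeG (Sig n) k ≤ G0) →
      (∀ n k, RankClime.tildeH (Sig n) k ≤ H0) →
      -- growth conditions
      (fun n => (RankClime.maxDegree (Sig n)⁻¹ : ℝ) ^ 2 * Real.log (p n))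
        =o[atTop] (fun n => (n : ℝ)) →
      (fun n => (RankClime.maxDegree (Sig n)⁻¹ : ℝ) * √(Real.log (p n) / n))
        =o[atTop] (fun n => RankClime.activeEigMin (Sig n)) →
      -- tuning of the first stage
      (∀ᶠ n in atTop, lamc n ≤ 1 / (RankClime.maxDegree (Sig n)⁻¹ : ℝ)) →
      (fun n => lamc n) =O[atTop] (fun n => √(Real.log (p n) / n)) →
      (∀ᶠ n in atTop,
        C * RankClime.matrixL1 (Sig n)⁻¹ * √(Real.log (p n) / n) ≤ lamc n) →
      -- tuning of the second stage
      (∀ n, 0 < lamac n) →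
      lamac =o[atTop] (fun n =>
        min (RankClime.activeEigMin (Sig n) / (RankClime.maxDegree (Sig n)⁻¹ : ℝ))
          (1 / (RankClime.maxDegree (Sig n)⁻¹ : ℝ))) →
      lamc =o[atTop] lamac →
      -- with probability tending to one, sign consistency
      Tendsto (fun n => μ n {ω | RankClime.AdaptiveClimeSucceeds n
        (RankClime.rankCorr (fun k => X n k ω)) (Sig n)⁻¹ (lamc n) (lamac n)}) atTop (𝓝 1) := by
  refine ⟨128, by norm_num, ?_⟩
  intro psi0 M0 G0 H0 hpsi0 p Sig P Ω _ μ _ X lamc lamac hP hX hlaw hind hedge hpsi hM hG hH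
    hgrow _ _ hO hlow hpos hlamac hlam
  have hS : ∀ n, (Sig n).PosDef := fun n => (hP n).posDef
  have hd : ∀ n i, Sig n i i = 1 := fun n => (hP n).diag_eq_one
  have hp2 : ∀ n, 2 ≤ p n := fun n => RankClime.two_le_of_offSupport_nonempty (hedge n)
  have hM1 : ∀ n, 1 ≤ RankClime.matrixL1 (Sig n)⁻¹ := fun n =>
    RankClime.one_le_matrixL1_inv (hS n) (hd n) ⟨0, by linarith [hp2 n]⟩
  have hlow' : ∀ᶠ n in atTop, √(Real.log (p n) / n) ≤ lamc n := by
    filter_upwards [hlow] with n hn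
    refine le_trans (le_mul_of_one_le_left (Real.sqrt_nonneg _) ?_) hn
    linarith [hM1 n]
  have hsucc : ∀ {K : ℝ}, 0 ≤ K → _ := fun {K} hK =>
    RankClime.eventually_adaptiveClimeSucceeds hpsi0 hS hd hedge hpsi hM hG hH hgrow hO hlow' hpos
      hlamac hlam hK
  have hds := RankClime.tendsto_mul_sqrt_of_isLittleO hgrow
  have hst : Tendsto (fun n => √(Real.log (p n) / n)) atTop (𝓝 0) := by
    refine squeeze_zero (fun n => Real.sqrt_nonneg _) (fun n => ?_) hds
    refine le_mul_of_one_le_left (Real.sqrt_nonneg _) ?_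
    exact_mod_cast RankClime.one_le_maxDegree (hedge n)
  refine RankClime.tendsto_measure_one_of_compl_le fun ε hε => ?_
  -- dimensions below `N` are treated with a large multiple `K` of the rate
  obtain ⟨K, hK, hKε⟩ : ∃ K : ℝ, 128 ≤ K ∧ 2 * Real.exp (-(K ^ 2 / 1536 * Real.log 2)) ≤ ε := by
    have ht : Tendsto (fun K : ℝ => 2 * Real.exp (-(K ^ 2 / 1536 * Real.log 2))) atTop
        (𝓝 (2 * 0)) := by
      refine Tendsto.const_mul 2 (Real.tendsto_exp_neg_atTop_nhds_zero.comp ?_)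
      refine Tendsto.atTop_mul_const (Real.log_pos one_lt_two) ?_
      exact (tendsto_pow_atTop two_ne_zero).atTop_div_const (by norm_num)
    rw [mul_zero] at ht
    obtain ⟨K, h1, h2⟩ := ((eventually_ge_atTop (128 : ℝ)).and (ht.eventually_lt_const hε)).exists
    exact ⟨K, h1, h2.le⟩
  obtain ⟨N, hN⟩ : ∃ N : ℕ, 2 / ε ≤ N := exists_nat_ge _
  have hsmall : ∀ᶠ n in atTop,
      max M0 1 * N * K * √(Real.log (p n) / n) < 1 / 2 := by
    have := hst.const_mul (max M0 1 * N * K)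
    rw [mul_zero] at this
    exact this.eventually_lt_const (by norm_num)
  filter_upwards [eventually_ge_atTop 3, hlow, hlow', hsmall, hsucc (by norm_num : (0 : ℝ) ≤ 128),
    hsucc (by linarith : 0 ≤ K)] with n hn hlown hlown' hsmalln hsuccC hsuccK
  rcases le_or_gt N (p n) with hpN | hpN
  · refine le_trans (measure_mono ?_)
      ((RankClime.measure_rankCorr_deviation_le (hP n) (hX n) (hlaw n) (hind n) hn (hp2 n)
        (le_refl (128 : ℝ))).trans (ENNReal.ofReal_le_ofReal ?_))
    · intro ω hω hgood
      refine hω (hsuccC _ (Sig n)⁻¹ hgood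
        (RankClime.inv_feasible (hS n) rfl hgood (by linarith)) fun k => ?_)
      have h1 := RankClime.sum_abs_col_le_matrixL1 (Sig n)⁻¹ k
      have h2 := hM n
      have h3 := le_max_left M0 1
      have h4 := le_max_right M0 1
      linarith
    · have hp0 : (0 : ℝ) < p n := by
        have := hp2 n
        positivity
      have hlog : 0 ≤ Real.log (p n) := Real.log_natCast_nonneg _
      calc 2 * Real.exp (-((128 : ℝ) ^ 2 / 1536 * Real.log (p n)))
          ≤ 2 * Real.exp (-Real.log (p n)) := by
            gcongr
            nlinarith
        _ = 2 / p n := by rw [Real.exp_neg, Real.exp_log hp0, div_eq_mul_inv]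
        _ ≤ ε := by
            rw [div_le_iff₀ hp0]
            rw [div_le_iff₀ hε] at hN
            have : (N : ℝ) ≤ p n := by exact_mod_cast hpN
            nlinarith
  · refine le_trans (measure_mono ?_)
      ((RankClime.measure_rankCorr_deviation_le (hP n) (hX n) (hlaw n) (hind n) hn (hp2 n)
        hK).trans (ENNReal.ofReal_le_ofReal ?_))
    · intro ω hω hgood
      obtain ⟨T₀, hT₀, hT₀M⟩ := RankClime.exists_rightInverse (M := max M0 1) (hS n)
        ((hM n).trans (le_max_left _ _)) (by positivity) hgood (by
          have h1 : (p n : ℝ) ≤ N := by exact_mod_cast hpN.le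
          have h2 : 0 ≤ K * √(Real.log (p n) / n) := by positivity
          have h3 := mul_le_mul_of_nonneg_left (mul_le_mul_of_nonneg_right h1 h2)
            (by positivity : 0 ≤ max M0 1)
          linarith)
      refine hω (hsuccK _ T₀ hgood (fun i j => ?_) hT₀M)
      rw [hT₀, sub_self, Matrix.zero_apply, abs_zero]
      exact (Real.sqrt_nonneg _).trans hlown'
    · refine le_trans ?_ hKε
      have : Real.log 2 ≤ Real.log (p n) :=
        Real.log_le_log (by norm_num) (by exact_mod_cast hp2 n)
      gcongr
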